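/- Let $X$ be a separable metric space. Let $\mathrm{Lip}(X)$ be the real Lipschitz functions on $X$ and $\mathrm{Lip}_b(X)$ the bounded ones. **Arens–Eells space.** $\text{Æ}(X)$ is the completion of the space of molecules $m=\sum_j\eta_j\delta_{x_j}$ (finite sums, $\sum_j\eta_j=0$) with respect to $\rho(m)=\inf\{\sum_j|\eta_j|\,d(x_j,y_j): m=\sum_j\eta_j(\delta_{x_j}-\delta_{y_j})\}$. An element $\lambda$ is regarded as a linear functional $f\mapsto\langle\lambda,f\rangle$ on $\mathrm{Lip}(X)$, by continuous extension of $\langle m,f\rangle=\sum_j\eta_jf(x_j)$. Write $\|\lambda\|_{KR}=\sup\{\langle\lambda,f\rangle:\mathrm{Lip}(f)\le1\}$. **Metric 1-currents.** $\mathbf M_1(X)$ is the set of bilinear functionals $T(f,\pi)$ on $\mathrm{Lip}_b(X)\times\mathrm{Lip}(X)$ such that: (i) there is a finite Borel measure $\mu$ with $|T(f,\pi)|\le\mathrm{Lip}(\pi)\int|f|\,d\mu$ for all $f,\pi$; (ii) $T(f,\pi_j)\to T(f,\pi)$ if $\pi_j\to\pi$ pointwise and $\sup_j\mathrm{Lip}(\pi_j)<\infty$;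 (iii) $T(f,\pi)=0$ if $\pi$ is constant on a neighbourhood of $\mathrm{spt} f$. The minimal $\mu$ in (i) is the mass measure $\|T\|$; $\mathbf M(T)=\|T\|(X)$; the boundary is $\partial T(f)=T(1,f)$, $f\in\mathrm{Lip}(X)$. $T\in\mathcal R_1(X)$ (rectifiable) means that $\|T\|\ll\mathcal H^1$ and that $\|T\|$ is concentrated on a countable union of Lipschitz images of bounded subsets of $\mathbb R$. **Connectedness.** For a Lipschitz curve $\theta:[0,1]\to X$ put $\ell(\theta)=\int_0^1\limsup_{h\to0^+}\frac{d(\theta(t+h),\theta(t))}{h}\,dt$. $X$ is *piecewise quasiconvex* if there is $c\ge1$ such that for all $x,y\in X$ and $\varepsilon>0$ there are $m\ge1$ and Lipschitz curves $\theta_1,\dots,\theta_m:[0,1]\to X$, from $x_i$ to $y_i$, with $d(x,x_1)+d(y_m,y)+\sum_{i=1}^{m-1}d(x_{i+1},y_i)<\varepsilon$ and $\sum_i\ell(\theta_i)\le c\,d(x,y)$. $X$ is *geodesic* if all $x,y\in X$ are joined by a Lipschitz curve of length $d(x,y)$. **Statement.** 1. If $X$ is piecewise quasiconvex, then $\|\lambda\|_{KR}$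 is the norm of $\lambda$ in $\text{Æ}(X)$ (so that the identification of $\lambda$ with a functional on $\mathrm{Lip}(X)$ is isometric), and, as sets of functionals on $\mathrm{Lip}(X)$, $$\text{Æ}(X)=\{\partial T: T\in\mathbf M_1(X)\}=\{\partial T: T\in\mathbf M_1(X)\cap\mathcal R_1(X)\}.$$ 2. If $X$ is geodesic, then for every $\lambda\in\text{Æ}(X)$ $$\|\lambda\|_{KR}=\inf\{\mathbf M(T): T\in\mathbf M_1(X),\ \partial T=\lambda\}.$$ 3. Let $X=\mathbb R^d$ be Euclidean. Let $\mathbf M_{0,1}(\mathbb R^d)$ be the space of linear functionals $\lambda$ on $\mathrm{Lip}(\mathbb R^d)$ with $\lambda(1)=0$ and $\lambda(f_j)\to\lambda(f)$ whenever $f_j\to f$ pointwise and $\sup_j\mathrm{Lip}(f_j)<\infty$; each of them is determined by the distribution obtained by restricting it to $C_c^\infty(\mathbb R^d)$, and is identified with it. Let $\mathscr F_1(\mathbb R^d)$ be the flat 1-chains of finite mass: the Federer–Fleming 1-currents of finite mass that lie in the closure of the normal 1-currents (those with $\mathbf M(N)+\mathbf M(\partial N)<\infty$) with respect to the flat norm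 $\mathbf F(T)=\inf\{\mathbf M(R)+\mathbf M(S): R+\partial S=T\}$. Here $\mathbf M(T)=\sup\{T(\omega):\|\omega\|\le1\}$ over smooth compactly supported forms with comass at most $1$ at every point, and $\partial T(\omega)=T(d\omega)$. Then $$\text{Æ}(\mathbb R^d)=\mathbf M_{0,1}(\mathbb R^d)=\{\partial T: T\in\mathscr F_1(\mathbb R^d)\},$$ and for every $\lambda\in\text{Æ}(\mathbb R^d)$ $$\|\lambda\|_{KR}=\inf\{\mathbf M(T): T\in\mathscr F_1(\mathbb R^d),\ \partial T=\lambda\}.$$ -/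

import Mathlib

open MeasureTheory Filter Topology Set
open scoped NNReal ENNReal

noncomputable section

namespace MetricBoundary

/-! ### Lipschitz functions -/

/-- The vector space `Lip(X)` of real-valued Lipschitz functions. -/
def LipFun (X : Type*) [PseudoMetricSpace X] : Submodule ℝ (X → ℝ) where
  carrier := {f | ∃ K : ℝ≥0, LipschitzWith K f}
  zero_mem' := ⟨0, LipschitzWith.const 0⟩
  add_mem' := by
    rintro f g ⟨K, hf⟩ ⟨L, hg⟩
    exact ⟨K + L, hf.add hg⟩
  smul_mem' := by
    rintro c f ⟨K, hf⟩
    exact ⟨‖c‖₊ * K, (lipschitzWith_smul c).comp hf⟩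

/-- The vector space `Lip_b(X)` of bounded real-valued Lipschitz functions. -/
def BddLipFun (X : Type*) [PseudoMetricSpace X] : Submodule ℝ (X → ℝ) where
  carrier := {f | (∃ K : ℝ≥0, LipschitzWith K f) ∧ ∃ C : ℝ, ∀ x, |f x| ≤ C}
  zero_mem' := ⟨⟨0, LipschitzWith.const 0⟩, 0, fun x => by simp⟩
  add_mem' := by
    rintro f g ⟨hf, C, hC⟩ ⟨hg, D, hD⟩
    exact ⟨(LipFun X).add_mem hf hg, C + D, fun x =>
      (abs_add_le _ _).trans (add_le_add (hC x) (hD x))⟩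
  smul_mem' := by
    rintro c f ⟨hf, C, hC⟩
    refine ⟨(LipFun X).smul_mem c hf, |c| * C, fun x => ?_⟩
    simp only [Pi.smul_apply, smul_eq_mul, abs_mul]
    exact mul_le_mul_of_nonneg_left (hC x) (abs_nonneg c)

/-- The constant function `1` as an element of `Lip(X)`. -/
def oneLip (X : Type*) [PseudoMetricSpace X] : LipFun X :=
  ⟨fun _ => 1, 0, LipschitzWith.const 1⟩

/-- The constant function `1` as an element of `Lip_b(X)`. -/
def oneBdd (X : Type*) [PseudoMetricSpace X] : BddLipFun X :=
  ⟨fun _ => 1, ⟨0, LipschitzWith.const 1⟩, 1, fun _ => by simp⟩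

/-- The Kantorovich-Rubinstein norm of a linear functional on `Lip(X)`: the supremum of its values
on the `1`-Lipschitz functions. -/
def krNorm {X : Type*} [PseudoMetricSpace X] (φ : LipFun X →ₗ[ℝ] ℝ) : ℝ≥0∞ :=
  ⨆ (f : LipFun X) (_ : LipschitzWith 1 f.1), ENNReal.ofReal (φ f)

/-- Sequential weak-* continuity on `Lip(X)`: continuity along equi-Lipschitz sequences that
converge pointwise. -/
def IsSeqWeakStarContinuous {X : Type*} [PseudoMetricSpace X] (φ : LipFun X →ₗ[ℝ] ℝ) : Prop :=
  ∀ (f : ℕ → LipFun X) (g : LipFun X) (K : ℝ≥0), (∀ j, LipschitzWith K (f j).1) →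
    (∀ x, Tendsto (fun j => (f j).1 x) atTop (𝓝 (g.1 x))) →
    Tendsto (fun j => φ (f j)) atTop (𝓝 (φ g))

/-! ### The Arens-Eells space -/

/-- Finite sums `∑ η_j δ_{x_j}` with `∑ η_j = 0`, as a space of finitely supported functions. -/
def moleculeSubmodule (X : Type*) : Submodule ℝ (X →₀ ℝ) :=
  LinearMap.ker (Finsupp.linearCombination ℝ (fun _ : X => (1 : ℝ)))

/-- The space of molecules on `X`. -/
def Molecule (X : Type*) : Type _ := moleculeSubmodule X

instance (X : Type*) : AddCommGroup (Molecule X) :=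
  inferInstanceAs (AddCommGroup (moleculeSubmodule X))

instance (X : Type*) : Module ℝ (Molecule X) :=
  inferInstanceAs (Module ℝ (moleculeSubmodule X))

/-- The finitely supported function underlying a molecule. -/
def Molecule.toFinsupp {X : Type*} : Molecule X →ₗ[ℝ] (X →₀ ℝ) := (moleculeSubmodule X).subtype

/-- The atom `δ_x - δ_y`. -/
def atom {X : Type*} (x y : X) : X →₀ ℝ := Finsupp.single x 1 - Finsupp.single y 1

/-- The costs `∑ |η_j| d(x_j, y_j)` of all atomic representations
`m = ∑ η_j (δ_{x_j} - δ_{y_j})` of `m`. -/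
def atomicCosts {X : Type*} [PseudoMetricSpace X] (m : X →₀ ℝ) : Set ℝ :=
  {r | ∃ (n : ℕ) (η : Fin n → ℝ) (x y : Fin n → X),
    m = ∑ j, η j • atom (x j) (y j) ∧ r = ∑ j, |η j| * dist (x j) (y j)}

/-- The norm `ρ(m)`: the infimum of the costs of the atomic representations of `m`. -/
instance (X : Type*) [PseudoMetricSpace X] : Norm (Molecule X) :=
  ⟨fun m => sInf (atomicCosts (Molecule.toFinsupp m))⟩

section rho

variable {X : Type*} [PseudoMetricSpace X]

theorem Molecule.norm_def (m : Molecule X) :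
    ‖m‖ = sInf (atomicCosts (Molecule.toFinsupp m)) := rfl

theorem atomicCosts_nonneg {m : X →₀ ℝ} {r : ℝ} (hr : r ∈ atomicCosts m) : 0 ≤ r := by
  obtain ⟨n, η, x, y, -, rfl⟩ := hr
  exact Finset.sum_nonneg fun j _ => mul_nonneg (abs_nonneg _) dist_nonneg

theorem atomicCosts_bddBelow (m : X →₀ ℝ) : BddBelow (atomicCosts m) :=
  ⟨0, fun _ hr => atomicCosts_nonneg hr⟩

theorem atomicCosts_add {m m' : X →₀ ℝ} {r r' : ℝ} (hr : r ∈ atomicCosts m)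
    (hr' : r' ∈ atomicCosts m') : r + r' ∈ atomicCosts (m + m') := by
  obtain ⟨n, η, x, y, rfl, rfl⟩ := hr
  obtain ⟨n', η', x', y', rfl, rfl⟩ := hr'
  refine ⟨n + n', Fin.append η η', Fin.append x x', Fin.append y y', ?_, ?_⟩ <;>
    simp [Fin.sum_univ_add]

theorem atomicCosts_smul (c : ℝ) {m : X →₀ ℝ} {r : ℝ} (hr : r ∈ atomicCosts m) :
    |c| * r ∈ atomicCosts (c • m) := by
  obtain ⟨n, η, x, y, rfl, rfl⟩ := hr
  refine ⟨n, fun j => c * η j, x, y, ?_, ?_⟩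
  · simp [Finset.smul_sum, smul_smul]
  · simp [Finset.mul_sum, abs_mul, mul_assoc]

theorem atomicCosts_nonempty (m : Molecule X) : (atomicCosts (Molecule.toFinsupp m)).Nonempty := by
  obtain ⟨m, hm⟩ := m
  change (atomicCosts m).Nonempty
  have key : ∀ (x₀ : X) (p : X →₀ ℝ),
      (atomicCosts (p - Finsupp.single x₀ (Finsupp.linearCombination ℝ
        (fun _ : X => (1 : ℝ)) p))).Nonempty := by
    intro x₀ p
    induction p using Finsupp.induction_linear with
    | zero => exact ⟨0, 0, Fin.elim0, Fin.elim0, Fin.elim0, by simp, by simp⟩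
    | add f g hf hg =>
      obtain ⟨r, hr⟩ := hf
      obtain ⟨s, hs⟩ := hg
      refine ⟨r + s, ?_⟩
      have := atomicCosts_add hr hs
      rwa [sub_add_sub_comm, ← Finsupp.single_add, ← map_add] at this
    | single a b =>
      refine ⟨_, 1, fun _ => b, fun _ => a, fun _ => x₀, ?_, rfl⟩
      simp [atom, smul_sub]
  rcases isEmpty_or_nonempty X with h | ⟨⟨x₀⟩⟩
  · refine ⟨0, 0, Fin.elim0, Fin.elim0, Fin.elim0, ?_, by simp⟩
    ext x
    exact h.elim x
  · have := key x₀ m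
    rwa [LinearMap.mem_ker.1 hm, Finsupp.single_zero, sub_zero] at this

theorem Molecule.norm_smul_le (c : ℝ) (m : Molecule X) : ‖c • m‖ ≤ |c| * ‖m‖ := by
  rw [Molecule.norm_def, Molecule.norm_def, ← smul_eq_mul, ← Real.sInf_smul_of_nonneg (abs_nonneg c)]
  refine le_csInf ((atomicCosts_nonempty m).smul_set) ?_
  rintro _ ⟨r, hr, rfl⟩
  refine csInf_le (atomicCosts_bddBelow _) ?_
  rw [map_smul]
  exact atomicCosts_smul c hr

theorem Molecule.core (X : Type*) [PseudoMetricSpace X] :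
    SeminormedSpace.Core ℝ (Molecule X) where
  norm_nonneg m := Real.sInf_nonneg fun _ hr => atomicCosts_nonneg hr
  norm_smul c m := by
    rw [Real.norm_eq_abs]
    refine le_antisymm (Molecule.norm_smul_le c m) ?_
    rcases eq_or_ne c 0 with rfl | hc
    · rw [abs_zero, zero_mul]
      exact Real.sInf_nonneg fun _ hr => atomicCosts_nonneg hr
    · have h := Molecule.norm_smul_le c⁻¹ (c • m)
      rw [smul_smul, inv_mul_cancel₀ hc, one_smul, abs_inv] at h
      have hc' : 0 < |c| := abs_pos.2 hc
      calc |c| * ‖m‖ ≤ |c| * (|c|⁻¹ * ‖c • m‖) := mul_le_mul_of_nonneg_left h hc'.le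
        _ = ‖c • m‖ := by rw [← mul_assoc, mul_inv_cancel₀ hc'.ne', one_mul]
  norm_triangle m m' := by
    refine le_of_forall_pos_le_add fun ε hε => ?_
    obtain ⟨r, hr, hr'⟩ := exists_lt_of_csInf_lt (atomicCosts_nonempty m)
      (lt_add_of_pos_right _ (half_pos hε))
    obtain ⟨s, hs, hs'⟩ := exists_lt_of_csInf_lt (atomicCosts_nonempty m')
      (lt_add_of_pos_right _ (half_pos hε))
    have h : ‖m + m'‖ ≤ r + s := by
      refine csInf_le (atomicCosts_bddBelow _) ?_
      rw [map_add]
      exact atomicCosts_add hr hs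
    rw [← Molecule.norm_def] at hr' hs'
    linarith

end rho

instance (X : Type*) [PseudoMetricSpace X] : SeminormedAddCommGroup (Molecule X) :=
  SeminormedAddCommGroup.ofCore (Molecule.core X)

instance (X : Type*) [PseudoMetricSpace X] : NormedSpace ℝ (Molecule X) :=
  { norm_smul_le := fun c m => ((Molecule.core X).norm_smul c m).le }

/-- The Arens-Eells space of `X`: the completion of the molecules with respect to `ρ`. -/
abbrev AE (X : Type*) [PseudoMetricSpace X] : Type _ := UniformSpace.Completion (Molecule X)

section pairing

variable {X : Type*} [PseudoMetricSpace X]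

/-- The pairing `⟨m, f⟩ = ∑ η_j f(x_j)` of a molecule `m = ∑ η_j δ_{x_j}` with a function. -/
def moleculePairing (f : X → ℝ) : Molecule X →ₗ[ℝ] ℝ :=
  (Finsupp.linearCombination ℝ f).comp Molecule.toFinsupp

theorem abs_moleculePairing_le {f : X → ℝ} {K : ℝ≥0} (hf : LipschitzWith K f) (m : Molecule X) :
    |moleculePairing f m| ≤ K * ‖m‖ := by
  rw [Molecule.norm_def, ← smul_eq_mul, ← Real.sInf_smul_of_nonneg (a := (K : ℝ)) K.2]
  refine le_csInf ((atomicCosts_nonempty m).smul_set) ?_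
  rintro _ ⟨_, ⟨n, η, x, y, h, rfl⟩, rfl⟩
  simp only [moleculePairing, LinearMap.comp_apply]
  rw [h, map_sum]
  refine (Finset.abs_sum_le_sum_abs _ _).trans ?_
  rw [smul_eq_mul, Finset.mul_sum]
  refine Finset.sum_le_sum fun j _ => ?_
  have h1 : Finsupp.linearCombination ℝ f (η j • atom (x j) (y j))
      = η j * (f (x j) - f (y j)) := by
    simp [atom]
  rw [h1, abs_mul]
  have h2 : |f (x j) - f (y j)| ≤ K * dist (x j) (y j) := by
    simpa [Real.dist_eq] using hf.dist_le_mul (x j) (y j)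
  calc |η j| * |f (x j) - f (y j)| ≤ |η j| * (K * dist (x j) (y j)) :=
        mul_le_mul_of_nonneg_left h2 (abs_nonneg _)
    _ = K * (|η j| * dist (x j) (y j)) := by ring

/-- The pairing with a Lipschitz function as a continuous linear functional on molecules. -/
def moleculePairingCLM (f : LipFun X) : Molecule X →L[ℝ] ℝ :=
  LinearMap.mkContinuousOfExistsBound (moleculePairing f.1)
    (by
      obtain ⟨K, hK⟩ := f.2
      exact ⟨K, fun m => abs_moleculePairing_le hK m⟩)

/-- The canonical pairing `⟨u, f⟩` of `u` in the Arens-Eells space with a Lipschitz function: the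
continuous extension of the pairing of molecules with `f`. -/
def pairing (u : AE X) (f : LipFun X) : ℝ :=
  UniformSpace.Completion.extension (moleculePairingCLM f) u

theorem pairing_coe (m : Molecule X) (f : LipFun X) :
    pairing (m : AE X) f = moleculePairing f.1 m :=
  UniformSpace.Completion.extension_coe (moleculePairingCLM f).uniformContinuous m

theorem continuous_pairing (f : LipFun X) : Continuous fun u : AE X => pairing u f :=
  UniformSpace.Completion.continuous_extension

/-- An element of the Arens-Eells space, seen as a linear functional on `Lip(X)`. -/
def toFunctional (u : AE X) : LipFun X →ₗ[ℝ] ℝ where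
  toFun := pairing u
  map_add' f g := by
    induction u using UniformSpace.Completion.induction_on with
    | hp =>
      exact isClosed_eq (continuous_pairing _) ((continuous_pairing _).add (continuous_pairing _))
    | ih m =>
      simp only [pairing_coe, moleculePairing, LinearMap.comp_apply,
        Finsupp.linearCombination_apply, Submodule.coe_add, Pi.add_apply, smul_add,
        Finsupp.sum_add]
  map_smul' c f := by
    induction u using UniformSpace.Completion.induction_on with
    | hp =>
      exact isClosed_eq (continuous_pairing _) ((continuous_pairing _).const_smul c)
    | ih m =>
      simp only [pairing_coe, moleculePairing, LinearMap.comp_apply,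
        Finsupp.linearCombination_apply, Submodule.coe_smul, Pi.smul_apply, smul_comm _ c,
        Finsupp.smul_sum, RingHom.id_apply]

end pairing

/-! ### Metric 1-currents -/

section currents

variable {X : Type*} [MetricSpace X] [MeasurableSpace X]

/-- `μ` is a finite measure with `|T(f, π)| ≤ Lip(π) ∫ |f| dμ` for all `(f, π)`. -/
def IsMassBound (T : BddLipFun X →ₗ[ℝ] LipFun X →ₗ[ℝ] ℝ) (μ : Measure X) : Prop :=
  IsFiniteMeasure μ ∧ ∀ (f : BddLipFun X) (π : LipFun X) (K : ℝ≥0), LipschitzWith K π.1 →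
    |T f π| ≤ K * ∫ x, |f.1 x| ∂μ

/-- Metric `1`-currents: bilinear functionals on `Lip_b(X) × Lip(X)` with finite mass, continuity
and locality. -/
structure IsMetricCurrent (T : BddLipFun X →ₗ[ℝ] LipFun X →ₗ[ℝ] ℝ) : Prop where
  finite_mass : ∃ μ : Measure X, IsMassBound T μ
  continuity : ∀ (f : BddLipFun X), IsSeqWeakStarContinuous (T f)
  locality : ∀ (f : BddLipFun X) (π : LipFun X),
    (∃ U : Set X, IsOpen U ∧ tsupport f.1 ⊆ U ∧ ∃ c : ℝ, ∀ x ∈ U, π.1 x = c) → T f π = 0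

/-- The mass measure `‖T‖`: the minimal measure that bounds `T`. (It is the greatest lower bound in
the complete lattice of measures of all measures that bound `T`.) -/
def massMeasure (T : BddLipFun X →ₗ[ℝ] LipFun X →ₗ[ℝ] ℝ) : Measure X :=
  sInf {μ | IsMassBound T μ}

/-- The mass `M(T) = ‖T‖(X)`. -/
def mass (T : BddLipFun X →ₗ[ℝ] LipFun X →ₗ[ℝ] ℝ) : ℝ≥0∞ := massMeasure T univ

/-- The boundary `∂T(f) = T(1, f)`, as a linear functional on `Lip(X)`. -/
def boundary (T : BddLipFun X →ₗ[ℝ] LipFun X →ₗ[ℝ] ℝ) : LipFun X →ₗ[ℝ] ℝ := T (oneBdd X)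

/-- Lipschitz images of bounded subsets of the real line. -/
def IsOneRectifiableSet (E : Set X) : Prop :=
  ∃ (B : Set ℝ) (γ : B → X) (K : ℝ≥0), Bornology.IsBounded B ∧ LipschitzWith K γ ∧ range γ = E

/-- `T` is rectifiable: its mass measure is concentrated on a countable union of `1`-rectifiable
sets and is absolutely continuous with respect to the `1`-dimensional Hausdorff measure. -/
def IsRectifiable [BorelSpace X] (T : BddLipFun X →ₗ[ℝ] LipFun X →ₗ[ℝ] ℝ) : Prop :=
  (∃ E : ℕ → Set X, (∀ n, IsOneRectifiableSet (E n)) ∧ massMeasure T (⋃ n, E n)ᶜ = 0) ∧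
    (massMeasure T).AbsolutelyContinuous (Measure.hausdorffMeasure (1 : ℝ))

end currents

/-! ### Curves and connectedness assumptions -/

section curves

variable {X : Type*} [MetricSpace X]

/-- The metric speed `|θ'|(t) = limsup_{h → 0+} d(θ(t + h), θ(t)) / h`. -/
def metricSpeed (θ : ℝ → X) (t : ℝ) : ℝ≥0∞ :=
  limsup (fun h : ℝ => ENNReal.ofReal (dist (θ (t + h)) (θ t) / h)) (𝓝[>] 0)

/-- The length `ℓ(θ) = ∫_0^1 |θ'|(t) dt`; it depends only on the restriction of `θ` to `[0, 1]`. -/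
def curveLength (θ : ℝ → X) : ℝ≥0∞ := ∫⁻ t in Ioo (0 : ℝ) 1, metricSpeed θ t

/-- `θ` restricts to a Lipschitz curve `[0, 1] → X`. -/
def IsLipCurve (θ : ℝ → X) : Prop := ∃ K : ℝ≥0, LipschitzOnWith K θ (Icc 0 1)

/-- Piecewise quasiconvex spaces. The pairs `(x_1, y_1), …, (x_m, y_m)` of the definition, with
`m = n + 1 ≥ 1`, are `(p 0, q 0), …, (p n, q n)`. -/
def PiecewiseQuasiconvex (X : Type*) [MetricSpace X] : Prop :=
  ∃ c : ℝ, 1 ≤ c ∧ ∀ (x y : X) (ε : ℝ), 0 < ε →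
    ∃ (n : ℕ) (p q : Fin (n + 1) → X) (θ : Fin (n + 1) → ℝ → X),
      dist x (p 0) + dist (q (Fin.last n)) y
        + ∑ i : Fin n, dist (p i.succ) (q i.castSucc) < ε ∧
      (∀ i, IsLipCurve (θ i) ∧ θ i 0 = p i ∧ θ i 1 = q i) ∧
      ∑ i, curveLength (θ i) ≤ ENNReal.ofReal (c * dist x y)

/-- Geodesic spaces: any two points are joined by a Lipschitz curve whose length is their
distance. -/
def Geodesic (X : Type*) [MetricSpace X] : Prop :=
  ∀ x y : X, ∃ θ : ℝ → X, IsLipCurve θ ∧ θ 0 = x ∧ θ 1 = y ∧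
    curveLength θ = ENNReal.ofReal (dist x y)

end curves

/-! ### Federer-Fleming currents and flat chains in Euclidean space -/

section flat

/-- Euclidean space. -/
abbrev Euc (d : ℕ) : Type := EuclideanSpace ℝ (Fin d)

/-- Smooth compactly supported `k`-forms on Euclidean space. -/
def TestForm (d k : ℕ) : Submodule ℝ (Euc d → Euc d [⋀^Fin k]→L[ℝ] ℝ) where
  carrier := {ω | ContDiff ℝ (⊤ : ℕ∞) ω ∧ HasCompactSupport ω}
  zero_mem' := ⟨contDiff_const, HasCompactSupport.zero⟩
  add_mem' := fun hω hη => ⟨hω.1.add hη.1, hω.2.add hη.2⟩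
  smul_mem' := fun _ _ hω => ⟨contDiff_const.smul hω.1, hω.2.smul_left⟩

/-- The exterior derivative on test forms. -/
def extD (d k : ℕ) : TestForm d k →ₗ[ℝ] TestForm d (k + 1) where
  toFun ω := ⟨extDeriv ω.1, by
    constructor
    · exact (ContinuousAlternatingMap.alternatizeUncurryFinCLM ℝ (Euc d) ℝ).contDiff.comp
        (ω.2.1.fderiv_right (m := (⊤ : ℕ∞)) (by simp))
    · exact (ω.2.2.fderiv (𝕜 := ℝ)).comp_left (g := ContinuousAlternatingMap.alternatizeUncurryFin)
        (ContinuousAlternatingMap.alternatizeUncurryFinCLM ℝ (Euc d) ℝ).map_zero⟩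
  map_add' ω η := by
    ext1
    funext x
    exact extDeriv_add ((ω.2.1.differentiable (by simp)) x) ((η.2.1.differentiable (by simp)) x)
  map_smul' c ω := by
    ext1
    funext x
    exact extDeriv_smul c ω.1

/-- Linear functionals on test `k`-forms. Those of finite mass (below) are continuous for the
supremum norm, so they are exactly the Federer-Fleming `k`-currents of finite mass. -/
abbrev FFCurrent (d k : ℕ) : Type := TestForm d k →ₗ[ℝ] ℝ

/-- The mass `M(T) = sup {T(ω) : |ω(x)| ≤ 1 for all x}`. The operator norm of an alternating map
is its comass. -/
def ffMass {d k : ℕ} (T : FFCurrent d k) : ℝ≥0∞ :=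
  ⨆ (ω : TestForm d k) (_ : ∀ x, ‖ω.1 x‖ ≤ 1), ENNReal.ofReal (T ω)

/-- The boundary `∂T(ω) = T(dω)`. -/
def ffBoundary {d k : ℕ} (T : FFCurrent d (k + 1)) : FFCurrent d k := T.comp (extD d k)

/-- Normal currents: the current and its boundary have finite mass. -/
def IsNormal {d k : ℕ} (T : FFCurrent d (k + 1)) : Prop :=
  ffMass T < ∞ ∧ ffMass (ffBoundary T) < ∞

/-- The flat norm `F(T) = inf {M(R) + M(S) : R + ∂S = T}`. -/
def flatNorm {d k : ℕ} (T : FFCurrent d k) : ℝ≥0∞ :=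
  ⨅ (R : FFCurrent d k) (S : FFCurrent d (k + 1)) (_ : R + ffBoundary S = T), ffMass R + ffMass S

/-- Flat chains with finite mass: currents of finite mass in the closure of the normal currents
with respect to the flat norm. -/
def IsFlatChain {d k : ℕ} (T : FFCurrent d (k + 1)) : Prop :=
  ffMass T < ∞ ∧ ∀ ε : ℝ≥0∞, 0 < ε → ∃ N : FFCurrent d (k + 1), IsNormal N ∧ flatNorm (T - N) < ε

/-- A compactly supported smooth function (a test `0`-form) as a Lipschitz function. -/
def testToLip (d : ℕ) : TestForm d 0 →ₗ[ℝ] LipFun (Euc d) where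
  toFun ω := ⟨fun x => ω.1 x 0, by
    obtain ⟨K, hK⟩ := ContDiff.lipschitzWith_of_hasCompactSupport ω.2.2 ω.2.1 (by simp)
    exact ⟨_, (ContinuousAlternatingMap.apply ℝ (Euc d) ℝ
      (0 : Fin 0 → Euc d)).lipschitz.comp hK⟩⟩
  map_add' ω η := rfl
  map_smul' c ω := rfl

/-- The distribution induced by a functional on `Lip(ℝ^d)`. -/
def toDistribution {d : ℕ} (φ : LipFun (Euc d) →ₗ[ℝ] ℝ) : FFCurrent d 0 := φ.comp (testToLip d)

/-- The space `M_{0,1}(ℝ^d)`: functionals of zero average on `Lip(ℝ^d)` that are continuous with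
respect to weak-* convergence (and hence induce distributions of order at most one). -/
def M01 (d : ℕ) : Set (LipFun (Euc d) →ₗ[ℝ] ℝ) :=
  {φ | φ (oneLip (Euc d)) = 0 ∧ IsSeqWeakStarContinuous φ}

end flat

end MetricBoundary

end

noncomputable section

namespace MetricBoundary

/-! ### Molecules, duality and weak-* continuity -/

section molecules

variable {X : Type*}

/-! The proof rests on duality, a representation criterion and an iterative filling.

Duality: a functional of norm at most one on molecules is evaluation against a 1-Lipschitz function,
so Hahn–Banach identifies the norm with the supremum over 1-Lipschitz functions
(`krNorm_toFunctional`). Connectedness plays no role here.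

Representation: `exists_toFunctional_eq` recovers an element of the Arens–Eells space from a bounded
functional on a weak-* dense class of Lipschitz functions, provided the functional is small on
functions that vanish on a suitable finite set. In a separable space every weak-* continuous
functional that kills constants has this property
(`mem_range_toFunctional_of_isSeqWeakStarContinuous`), so boundaries of metric currents lie in the
Arens–Eells space. For a flat chain `T`, the property holds on test functions: up to a current of
small mass and a boundary, `T` is a normal current `N`, and for `N` one cuts off and uses a finite
net of a compact set (`IsFlatChain.exists_bound`).

Filling: if each atom is, up to small error, fillable at cost `c` times its distance, then removing
approximate fillings successively writes every `u` as a series of fillable elements of total cost at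
most `c * ‖u‖ + ε` (`AE.exists_hasSum`). The fillings are currents along Lipschitz curves in metric
spaces and segments in Euclidean space. The former are bounded by arc length measures, which are
rectifiable; the latter are normal, so their series converge in mass to flat chains.

The fillings give the upper bounds for the norm when `c = 1`. The lower bounds test the boundary
with 1-Lipschitz functions. For metric currents, the mass is defined through an infimum of measures,
and `ofReal_abs_le_sInf_univ` shows that this infimum still controls the boundary. -/

theorem Molecule.toFinsupp_injective : Function.Injective (Molecule.toFinsupp (X := X)) :=
  Subtype.val_injective

/-- The molecule `δ_x - δ_y`. -/
def atomMolecule (x y : X) : Molecule X :=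
  (⟨atom x y, by simp [moleculeSubmodule, atom]⟩ : moleculeSubmodule X)

theorem toFinsupp_atomMolecule (x y : X) : Molecule.toFinsupp (atomMolecule x y) = atom x y := rfl

theorem moleculePairing_atomMolecule (f : X → ℝ) (x y : X) :
    moleculePairing f (atomMolecule x y) = f x - f y := by
  simp [moleculePairing, toFinsupp_atomMolecule, atom]

theorem atomMolecule_sub (x y z : X) :
    atomMolecule x z - atomMolecule y z = atomMolecule x y := by
  apply Molecule.toFinsupp_injective
  simp [toFinsupp_atomMolecule, atom]

variable [PseudoMetricSpace X]

theorem norm_atomMolecule_le (x y : X) : ‖atomMolecule x y‖ ≤ dist x y := by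
  rw [Molecule.norm_def]
  refine csInf_le (atomicCosts_bddBelow _) ⟨1, fun _ => 1, fun _ => x, fun _ => y, ?_, ?_⟩ <;>
    simp [toFinsupp_atomMolecule]

theorem Molecule.exists_eq_sum_of_mem {m : Molecule X} {r : ℝ}
    (hr : r ∈ atomicCosts (Molecule.toFinsupp m)) :
    ∃ (n : ℕ) (η : Fin n → ℝ) (x y : Fin n → X),
      m = ∑ j, η j • atomMolecule (x j) (y j) ∧ r = ∑ j, |η j| * dist (x j) (y j) := by
  obtain ⟨n, η, x, y, h, rfl⟩ := hr
  refine ⟨n, η, x, y, Molecule.toFinsupp_injective ?_, rfl⟩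
  rw [h]
  simp [toFinsupp_atomMolecule]

/-- With a base point `x₀`, the function is `x ↦ g (δ_x - δ_{x₀})`. It is 1-Lipschitz because an
atom has norm at most the distance of its points, and it induces `g` because atoms span the
molecules. -/
theorem exists_moleculePairing_eq (g : Molecule X →ₗ[ℝ] ℝ) (hg : ∀ m, |g m| ≤ ‖m‖) :
    ∃ f : LipFun X, LipschitzWith 1 f.1 ∧ ∀ m, moleculePairing f.1 m = g m := by
  have rep : ∀ m : Molecule X, ∃ (n : ℕ) (η : Fin n → ℝ) (x y : Fin n → X),
      m = ∑ j, η j • atomMolecule (x j) (y j) := by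
    intro m
    obtain ⟨r, hr⟩ := atomicCosts_nonempty m
    obtain ⟨n, η, x, y, h, -⟩ := Molecule.exists_eq_sum_of_mem hr
    exact ⟨n, η, x, y, h⟩
  rcases isEmpty_or_nonempty X with h | ⟨⟨x₀⟩⟩
  · refine ⟨0, LipschitzWith.of_dist_le_mul fun x => h.elim x, fun m => ?_⟩
    obtain ⟨n, η, x, y, rfl⟩ := rep m
    rw [map_sum, map_sum]
    exact Finset.sum_congr rfl fun j _ => h.elim (x j)
  · have hL : LipschitzWith 1 fun x => g (atomMolecule x x₀) := by
      refine LipschitzWith.of_dist_le_mul fun x y => ?_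
      rw [Real.dist_eq, ← map_sub, atomMolecule_sub]
      simpa using (hg _).trans (norm_atomMolecule_le x y)
    refine ⟨⟨_, 1, hL⟩, hL, fun m => ?_⟩
    obtain ⟨n, η, x, y, rfl⟩ := rep m
    simp only [map_sum, map_smul, moleculePairing_atomMolecule, ← map_sub, atomMolecule_sub]

theorem pairing_add (u v : AE X) (f : LipFun X) :
    pairing (u + v) f = pairing u f + pairing v f := by
  induction u, v using UniformSpace.Completion.induction_on₂ with
  | hp =>
    have h := continuous_pairing f
    exact isClosed_eq (h.comp (continuous_fst.add continuous_snd))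
      ((h.comp continuous_fst).add (h.comp continuous_snd))
  | ih m m' => rw [← UniformSpace.Completion.coe_add, pairing_coe, pairing_coe, pairing_coe, map_add]

theorem pairing_smul (c : ℝ) (u : AE X) (f : LipFun X) :
    pairing (c • u) f = c * pairing u f := by
  induction u using UniformSpace.Completion.induction_on with
  | hp =>
    have h := continuous_pairing f
    exact isClosed_eq (h.comp (continuous_const_smul c)) (h.const_smul c)
  | ih m =>
    rw [← UniformSpace.Completion.coe_smul, pairing_coe, pairing_coe, map_smul, smul_eq_mul]

/-- The pairing as a linear map on the Arens-Eells space. -/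
def toFunctionalLM : AE X →ₗ[ℝ] LipFun X →ₗ[ℝ] ℝ where
  toFun := toFunctional
  map_add' u v := LinearMap.ext fun f => pairing_add u v f
  map_smul' c u := LinearMap.ext fun f => pairing_smul c u f

theorem toFunctionalLM_apply (u : AE X) : toFunctionalLM u = toFunctional u := rfl

theorem toFunctional_add (u v : AE X) : toFunctional (u + v) = toFunctional u + toFunctional v :=
  toFunctionalLM.map_add u v

theorem toFunctional_sub (u v : AE X) : toFunctional (u - v) = toFunctional u - toFunctional v :=
  toFunctionalLM.map_sub u v

theorem toFunctional_smul (c : ℝ) (u : AE X) : toFunctional (c • u) = c • toFunctional u :=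
  toFunctionalLM.map_smul c u

theorem toFunctional_coe (m : Molecule X) (f : LipFun X) :
    toFunctional (m : AE X) f = moleculePairing f.1 m := pairing_coe m f

theorem continuous_toFunctional (f : LipFun X) : Continuous fun u : AE X => toFunctional u f :=
  continuous_pairing f

theorem abs_toFunctional_le (u : AE X) {f : LipFun X} {K : ℝ≥0} (hf : LipschitzWith K f.1) :
    |toFunctional u f| ≤ K * ‖u‖ := by
  induction u using UniformSpace.Completion.induction_on with
  | hp =>
    exact isClosed_le (continuous_toFunctional f).abs (continuous_const.mul continuous_norm)
  | ih m =>
    rw [toFunctional_coe, UniformSpace.Completion.norm_coe]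
    exact abs_moleculePairing_le hf m

/-- The norming functional from Hahn–Banach restricts to molecules, where it is evaluation of a
1-Lipschitz function; density of molecules carries the identity to the completion. -/
theorem exists_toFunctional_eq_norm (u : AE X) :
    ∃ f : LipFun X, LipschitzWith 1 f.1 ∧ toFunctional u f = ‖u‖ := by
  obtain ⟨g, hg, hgu⟩ := exists_dual_vector'' ℝ u
  obtain ⟨f, hf, h⟩ := exists_moleculePairing_eq
    (g.toLinearMap.comp (UniformSpace.Completion.toComplL (𝕜 := ℝ) (E := Molecule X)).toLinearMap)
    (fun m => by
      have := g.le_opNorm (m : AE X)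
      rw [UniformSpace.Completion.norm_coe] at this
      exact this.trans (mul_le_of_le_one_left (norm_nonneg _) hg))
  refine ⟨f, hf, ?_⟩
  have key : ∀ v : AE X, toFunctional v f = g v := by
    intro v
    induction v using UniformSpace.Completion.induction_on with
    | hp => exact isClosed_eq (continuous_toFunctional f) g.continuous
    | ih m => rw [toFunctional_coe]; exact h m
  rw [key, hgu]
  rfl

/-- Kantorovich-Rubinstein duality. -/
theorem krNorm_toFunctional (u : AE X) : krNorm (toFunctional u) = ENNReal.ofReal ‖u‖ := by
  refine le_antisymm (iSup₂_le fun f hf => ENNReal.ofReal_le_ofReal ?_) ?_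
  · simpa using (le_abs_self _).trans (abs_toFunctional_le u hf)
  · obtain ⟨f, hf, h⟩ := exists_toFunctional_eq_norm u
    rw [← h]
    exact le_iSup₂ (f := fun (f : LipFun X) (_ : LipschitzWith 1 f.1) =>
      ENNReal.ofReal (toFunctional u f)) f hf

theorem isSeqWeakStarContinuous_moleculePairing (m : Molecule X) (f : ℕ → LipFun X) (g : LipFun X)
    (h : ∀ x, Tendsto (fun j => (f j).1 x) atTop (𝓝 (g.1 x))) :
    Tendsto (fun j => moleculePairing (f j).1 m) atTop (𝓝 (moleculePairing g.1 m)) := by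
  simp only [moleculePairing, LinearMap.comp_apply, Finsupp.linearCombination_apply, Finsupp.sum]
  exact tendsto_finsetSum _ fun x _ => (h x).const_smul _

/-- A molecule sees only finitely many values, and replacing `u` by a nearby molecule costs an error
that is uniform over all `K`-Lipschitz functions. -/
theorem isSeqWeakStarContinuous_toFunctional (u : AE X) :
    IsSeqWeakStarContinuous (toFunctional u) := by
  intro f g K hf h
  have hg : LipschitzWith K g.1 := by
    refine LipschitzWith.of_dist_le_mul fun x y => ?_
    exact le_of_tendsto ((h x).dist (h y)) (Eventually.of_forall fun j => (hf j).dist_le_mul x y)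
  rw [Metric.tendsto_atTop]
  intro ε hε
  obtain ⟨m, hm⟩ : ∃ m : Molecule X, ‖u - (m : AE X)‖ < ε / (3 * (K + 1)) := by
    obtain ⟨v, ⟨m, rfl⟩, hm⟩ := Metric.mem_closure_iff.1
      (UniformSpace.Completion.denseRange_coe (α := Molecule X) u) (ε / (3 * (K + 1)))
      (by positivity)
    exact ⟨m, by rwa [dist_eq_norm] at hm⟩
  have small : ∀ k : LipFun X, LipschitzWith K k.1 →
      |toFunctional u k - moleculePairing k.1 m| < ε / 3 := by
    intro k hk
    have h1 := abs_toFunctional_le (u - (m : AE X)) hk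
    rw [toFunctional_sub, LinearMap.sub_apply, toFunctional_coe] at h1
    have h2 : (K + 1 : ℝ) * ‖u - (m : AE X)‖ < ε / 3 := by
      have := mul_lt_mul_of_pos_left hm (show (0 : ℝ) < K + 1 by positivity)
      have e : (K + 1 : ℝ) * (ε / (3 * (K + 1))) = ε / 3 := by field_simp
      linarith
    have := norm_nonneg (u - (m : AE X))
    nlinarith
  obtain ⟨N, hN⟩ := Metric.tendsto_atTop.1 (isSeqWeakStarContinuous_moleculePairing m f g h)
    (ε / 3) (by positivity)
  refine ⟨N, fun j hj => ?_⟩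
  have h1 := abs_lt.1 (small (f j) (hf j))
  have h2 := abs_lt.1 (small g hg)
  have h3 := hN j hj
  rw [Real.dist_eq] at h3 ⊢
  have h3 := abs_lt.1 h3
  rw [abs_lt]
  constructor <;> linarith [h1.1, h1.2, h2.1, h2.2, h3.1, h3.2]

theorem toFunctional_oneLip (u : AE X) : toFunctional u (oneLip X) = 0 := by
  have := abs_toFunctional_le u (f := oneLip X) (K := 0) (LipschitzWith.const 1)
  simpa using this

end molecules

/-! ### Representation of functionals by elements of the Arens-Eells space -/

section representation

variable {X : Type*} [PseudoMetricSpace X]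

/-- The best Lipschitz constant of a Lipschitz function. -/
def lipConst (f : X → ℝ) : ℝ := sInf {K | 0 ≤ K ∧ ∀ x y, |f x - f y| ≤ K * dist x y}

theorem lipConst_le {f : X → ℝ} {K : ℝ} (hK : 0 ≤ K) (h : ∀ x y, |f x - f y| ≤ K * dist x y) :
    lipConst f ≤ K := csInf_le ⟨0, fun _ h => h.1⟩ ⟨hK, h⟩

theorem lipConst_nonneg (f : X → ℝ) : 0 ≤ lipConst f := Real.sInf_nonneg fun _ h => h.1

theorem abs_sub_le_lipConst (f : LipFun X) (x y : X) :
    |f.1 x - f.1 y| ≤ lipConst f.1 * dist x y := by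
  obtain ⟨K, hK⟩ := f.2
  have hne : {K | 0 ≤ K ∧ ∀ x y, |f.1 x - f.1 y| ≤ K * dist x y}.Nonempty :=
    ⟨K, K.2, fun x y => by simpa [Real.dist_eq] using hK.dist_le_mul x y⟩
  rw [mul_comm, lipConst, ← smul_eq_mul, ← Real.sInf_smul_of_nonneg dist_nonneg]
  refine le_csInf hne.smul_set ?_
  rintro _ ⟨L, hL, rfl⟩
  simpa [mul_comm] using hL.2 x y

theorem lipschitzWith_lipConst (f : LipFun X) :
    LipschitzWith ⟨lipConst f.1, lipConst_nonneg f.1⟩ f.1 :=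
  LipschitzWith.of_dist_le_mul fun x y => by
    rw [Real.dist_eq]; exact abs_sub_le_lipConst f x y

theorem lipConst_le_of_lipschitzWith {f : X → ℝ} {K : ℝ≥0} (h : LipschitzWith K f) :
    lipConst f ≤ K :=
  lipConst_le K.2 fun x y => by simpa [Real.dist_eq] using h.dist_le_mul x y

theorem lipConst_add_le (f g : LipFun X) : lipConst (f + g).1 ≤ lipConst f.1 + lipConst g.1 := by
  refine lipConst_le (add_nonneg (lipConst_nonneg _) (lipConst_nonneg _)) fun x y => ?_
  have h1 := abs_sub_le_lipConst f x y
  have h2 := abs_sub_le_lipConst g x y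
  calc |(f + g).1 x - (f + g).1 y| = |(f.1 x - f.1 y) + (g.1 x - g.1 y)| := by
        simp only [Submodule.coe_add, Pi.add_apply]; congr 1; ring
    _ ≤ _ := abs_add_le _ _
    _ ≤ _ := by linarith

theorem lipConst_smul_le {c : ℝ} (hc : 0 ≤ c) (f : LipFun X) :
    lipConst (c • f).1 ≤ c * lipConst f.1 := by
  refine lipConst_le (mul_nonneg hc (lipConst_nonneg _)) fun x y => ?_
  simp only [Submodule.coe_smul, Pi.smul_apply, smul_eq_mul, ← mul_sub, abs_mul, abs_of_nonneg hc,
    mul_assoc]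
  exact mul_le_mul_of_nonneg_left (abs_sub_le_lipConst f x y) hc

theorem lipConst_smul {c : ℝ} (hc : 0 < c) (f : LipFun X) :
    lipConst (c • f).1 = c * lipConst f.1 := by
  refine le_antisymm (lipConst_smul_le hc.le f) ?_
  have h := lipConst_smul_le (inv_nonneg.2 hc.le) (c • f)
  rw [smul_smul, inv_mul_cancel₀ hc.ne', one_smul] at h
  calc c * lipConst f.1 ≤ c * (c⁻¹ * lipConst (c • f).1) := mul_le_mul_of_nonneg_left h hc.le
    _ = _ := by rw [← mul_assoc, mul_inv_cancel₀ hc.ne', one_mul]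

variable {V : Type*} [AddCommGroup V] [Module ℝ V]

/-- On the subspace of functions vanishing on `F`, the functional is dominated by the seminorm `ε *
lipConst`. Hahn–Banach extends that restriction to some `g` with the same bound on all of `V`. Then
`ψ - g` vanishes wherever the evaluations at points of `F` do, so it is a combination of these
evaluations, and its coefficients form `m`. -/
theorem exists_finsupp_approx (ι : V →ₗ[ℝ] LipFun X) (ψ : V →ₗ[ℝ] ℝ) {ε : ℝ} (hε : 0 ≤ ε)
    (F : Finset X) (hF : ∀ (v : V) (K : ℝ≥0), LipschitzWith K (ι v).1 →
      (∀ x ∈ F, (ι v).1 x = 0) → |ψ v| ≤ ε * K) :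
    ∃ m : X →₀ ℝ, ∀ (v : V) (K : ℝ≥0), LipschitzWith K (ι v).1 →
      |ψ v - Finsupp.linearCombination ℝ (ι v).1 m| ≤ ε * K := by
  let ev : F → V →ₗ[ℝ] ℝ := fun x => (LinearMap.proj x.1).comp ((LipFun X).subtype.comp ι)
  have hev : ∀ x v, ev x v = (ι v).1 x.1 := fun _ _ => rfl
  obtain ⟨g, hg, hgN⟩ := exists_extension_of_le_sublinear
    (⟨⨅ x, LinearMap.ker (ev x), ψ.domRestrict _⟩ : V →ₗ.[ℝ] ℝ)
    (fun v => ε * lipConst (ι v).1)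
    (fun c hc v => by rw [map_smul, lipConst_smul hc]; ring)
    (fun v w => by
      rw [map_add, ← mul_add]
      exact mul_le_mul_of_nonneg_left (lipConst_add_le _ _) hε)
    (by
      rintro ⟨v, hv⟩
      refine (le_abs_self _).trans (hF v _ (lipschitzWith_lipConst (ι v)) fun x hx => ?_)
      exact LinearMap.mem_ker.1 ((Submodule.mem_iInf _).1 hv ⟨x, hx⟩))
  have hgN' : ∀ v, |g v| ≤ ε * lipConst (ι v).1 := by
    intro v
    refine abs_le.2 ⟨?_, hgN v⟩
    have h := hgN (-v)
    have e : lipConst (ι (-v)).1 ≤ lipConst (ι v).1 := by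
      refine lipConst_le (lipConst_nonneg _) fun x y => ?_
      rw [map_neg]
      simp only [Submodule.coe_neg, Pi.neg_apply]
      rw [← neg_sub', abs_neg]
      exact abs_sub_le_lipConst _ x y
    have := mul_le_mul_of_nonneg_left e hε
    rw [map_neg] at h
    linarith
  have hspan : ψ - g ∈ Submodule.span ℝ (range ev) := by
    refine mem_span_of_iInf_ker_le_ker fun v hv => ?_
    rw [LinearMap.mem_ker, LinearMap.sub_apply, hg ⟨v, hv⟩]
    exact sub_self _
  obtain ⟨c, hc⟩ := (Submodule.mem_span_range_iff_exists_fun ℝ).1 hspan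
  refine ⟨∑ x : F, Finsupp.single x.1 (c x), fun v K hv => ?_⟩
  have e : Finsupp.linearCombination ℝ (ι v).1 (∑ x : F, Finsupp.single x.1 (c x))
      = ψ v - g v := by
    rw [← LinearMap.sub_apply, ← hc, map_sum, LinearMap.sum_apply]
    refine Finset.sum_congr rfl fun x _ => ?_
    simp [hev]
  rw [e, sub_sub_cancel]
  exact (hgN' v).trans (mul_le_mul_of_nonneg_left (lipConst_le_of_lipschitzWith hv) hε)

/-- The functions in the range of `ι` are dense in `Lip(X)` for the weak-* convergence, with sharp
control of the Lipschitz constants. -/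
def IsLipDense (ι : V →ₗ[ℝ] LipFun X) : Prop :=
  ∀ (f : LipFun X) (K : ℝ≥0), 0 < K → LipschitzWith K f.1 → ∃ v : ℕ → V,
    (∀ j, LipschitzWith K (ι (v j)).1) ∧
      ∀ x, Tendsto (fun j => (ι (v j)).1 x) atTop (𝓝 (f.1 x))

/-- Weak-* density without loss in the Lipschitz constant lets test functions replace the
1-Lipschitz function that attains the norm. -/
theorem norm_le_of_isLipDense {ι : V →ₗ[ℝ] LipFun X} (hι : IsLipDense ι) (u : AE X) {C : ℝ}
    (h : ∀ v, LipschitzWith 1 (ι v).1 → toFunctional u (ι v) ≤ C) : ‖u‖ ≤ C := by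
  obtain ⟨f, hf, hfu⟩ := exists_toFunctional_eq_norm u
  obtain ⟨v, hv, hvf⟩ := hι f 1 one_pos hf
  rw [← hfu]
  exact le_of_tendsto (isSeqWeakStarContinuous_toFunctional u _ f 1 hv hvf)
    (Eventually.of_forall fun j => h _ (hv j))

theorem exists_molecule_approx {ι : V →ₗ[ℝ] LipFun X} (hι : IsLipDense ι) (ψ : V →ₗ[ℝ] ℝ) {M : ℝ}
    (hM : ∀ (v : V) (K : ℝ≥0), LipschitzWith K (ι v).1 → |ψ v| ≤ M * K) {ε : ℝ} (hε : 0 ≤ ε)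
    (F : Finset X) (hF : ∀ (v : V) (K : ℝ≥0), LipschitzWith K (ι v).1 →
      (∀ x ∈ F, (ι v).1 x = 0) → |ψ v| ≤ ε * K) :
    ∃ m : Molecule X, ∀ (v : V) (K : ℝ≥0), LipschitzWith K (ι v).1 →
      |ψ v - moleculePairing (ι v).1 m| ≤ ε * K := by
  obtain ⟨m, hm⟩ := exists_finsupp_approx ι ψ hε F hF
  suffices h : Finsupp.linearCombination ℝ (fun _ : X => (1 : ℝ)) m = 0 from
    ⟨(⟨m, LinearMap.mem_ker.2 h⟩ : moleculeSubmodule X), hm⟩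
  -- The total weight `s` must vanish for `m` to be a molecule. The constant `1` is a limit of
  -- `K`-Lipschitz test functions for every `K > 0`, on which `ψ` and the error are both `O(K)`;
  -- then `K` tends to zero.
  set s := Finsupp.linearCombination ℝ (fun _ : X => (1 : ℝ)) m with hs
  have key : ∀ K : ℝ≥0, 0 < K → |s| ≤ (ε + M) * K := by
    intro K hK
    obtain ⟨v, hv, hvf⟩ := hι (oneLip X) K hK ((LipschitzWith.const 1).weaken zero_le)
    have hlim : Tendsto (fun j => Finsupp.linearCombination ℝ (ι (v j)).1 m) atTop (𝓝 s) := by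
      simp only [hs, Finsupp.linearCombination_apply, Finsupp.sum]
      exact tendsto_finsetSum _ fun x _ => (hvf x).const_smul _
    refine le_of_tendsto hlim.abs (Eventually.of_forall fun j => ?_)
    have h1 := abs_le.1 (hm (v j) K (hv j))
    have h2 := abs_le.1 (hM (v j) K (hv j))
    rw [abs_le]
    constructor <;> linarith [h1.1, h1.2, h2.1, h2.2]
  have hlim : Tendsto (fun n : ℕ => (ε + M) * (((1 : ℝ≥0) / (n + 1) : ℝ≥0) : ℝ)) atTop (𝓝 0) := by
    have := (tendsto_one_div_add_atTop_nhds_zero_nat (𝕜 := ℝ)).const_mul (ε + M)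
    simpa using this
  exact abs_nonpos_iff.1 (ge_of_tendsto' hlim fun n => key _ (by positivity))

/-- A bounded linear functional on a weak-* dense space of Lipschitz functions, that is small on
functions vanishing on suitable finite sets, is induced by an element of the Arens-Eells space. -/
theorem exists_toFunctional_eq {ι : V →ₗ[ℝ] LipFun X} (hι : IsLipDense ι) (ψ : V →ₗ[ℝ] ℝ) {M : ℝ}
    (hM : ∀ (v : V) (K : ℝ≥0), LipschitzWith K (ι v).1 → |ψ v| ≤ M * K)
    (hF : ∀ ε : ℝ, 0 < ε → ∃ F : Finset X, ∀ (v : V) (K : ℝ≥0), LipschitzWith K (ι v).1 →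
      (∀ x ∈ F, (ι v).1 x = 0) → |ψ v| ≤ ε * K) :
    ∃ u : AE X, ∀ v, toFunctional u (ι v) = ψ v := by
  have H : ∀ n : ℕ, ∃ m : Molecule X, ∀ (v : V) (K : ℝ≥0), LipschitzWith K (ι v).1 →
      |ψ v - moleculePairing (ι v).1 m| ≤ (1 / (n + 1) : ℝ) * K := by
    intro n
    have hn : (0 : ℝ) < 1 / (n + 1) := by positivity
    obtain ⟨F, hF⟩ := hF _ hn
    exact exists_molecule_approx hι ψ hM hn.le F hF
  choose m hm using H
  -- Two approximants of `ψ` are close to each other on the dense class, and this class suffices to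
  -- compute the norm of their difference.
  have hd : ∀ k n : ℕ, ‖(m k : AE X) - m n‖ ≤ 1 / (k + 1) + 1 / (n + 1) := by
    intro k n
    refine norm_le_of_isLipDense hι _ fun v hv => ?_
    rw [toFunctional_sub, LinearMap.sub_apply, toFunctional_coe, toFunctional_coe]
    have h1 := abs_le.1 (hm k v 1 hv)
    have h2 := abs_le.1 (hm n v 1 hv)
    simp only [NNReal.coe_one, mul_one] at h1 h2
    linarith [h1.1, h2.2]
  have hc : CauchySeq fun n => (m n : AE X) := by
    refine cauchySeq_of_le_tendsto_0 (fun n : ℕ => 2 * (1 / (n + 1) : ℝ)) (fun k n N hk hn => ?_) ?_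
    · rw [dist_eq_norm]
      have h1 : (1 / (k + 1) : ℝ) ≤ 1 / (N + 1) := by gcongr
      have h2 : (1 / (n + 1) : ℝ) ≤ 1 / (N + 1) := by gcongr
      linarith [hd k n]
    · simpa using (tendsto_one_div_add_atTop_nhds_zero_nat (𝕜 := ℝ)).const_mul 2
  obtain ⟨u, hu⟩ := cauchySeq_tendsto_of_complete hc
  refine ⟨u, fun v => ?_⟩
  have h1 : Tendsto (fun n => toFunctional (m n : AE X) (ι v)) atTop (𝓝 (toFunctional u (ι v))) :=
    ((continuous_toFunctional (ι v)).tendsto u).comp hu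
  refine tendsto_nhds_unique h1 ?_
  obtain ⟨K, hK⟩ := (ι v).2
  rw [tendsto_iff_dist_tendsto_zero]
  refine squeeze_zero (fun _ => dist_nonneg) (fun n => ?_)
    (by simpa using (tendsto_one_div_add_atTop_nhds_zero_nat (𝕜 := ℝ)).mul_const (K : ℝ))
  rw [toFunctional_coe, dist_comm, Real.dist_eq]
  simpa using hm n v K hK

theorem isLipDense_id : IsLipDense (LinearMap.id : LipFun X →ₗ[ℝ] LipFun X) :=
  fun f _ _ hf => ⟨fun _ => f, fun _ => hf, fun _ => tendsto_const_nhds⟩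

/-! ### Weak-* continuous functionals of zero average -/

theorem map_const_eq_zero {φ : LipFun X →ₗ[ℝ] ℝ} (h1 : φ (oneLip X) = 0) (f : LipFun X) (c : ℝ)
    (hf : ∀ x, f.1 x = c) : φ f = 0 := by
  have : f = c • oneLip X := by
    ext x
    simp [hf, oneLip]
  rw [this, map_smul, h1, smul_zero]

/-- If no bound existed, there would be 1-Lipschitz functions vanishing at `x₀` on which `φ` is at
least `n²` in absolute value. Dividing them by `n + 1` gives an equi-Lipschitz sequence that tends
to zero pointwise while `φ` does not. -/
theorem exists_bound_of_isSeqWeakStarContinuous {φ : LipFun X →ₗ[ℝ] ℝ} (h1 : φ (oneLip X) = 0)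
    (hφ : IsSeqWeakStarContinuous φ) :
    ∃ M : ℝ, ∀ (f : LipFun X) (K : ℝ≥0), LipschitzWith K f.1 → |φ f| ≤ M * K := by
  rcases isEmpty_or_nonempty X with h | ⟨⟨x₀⟩⟩
  · refine ⟨0, fun f K _ => ?_⟩
    rw [map_const_eq_zero h1 f 0 fun x => h.elim x]
    simp
  by_contra! hM
  have H : ∀ n : ℕ, ∃ f : LipFun X, LipschitzWith 1 f.1 ∧ f.1 x₀ = 0 ∧ (n : ℝ) ≤ |φ f| := by
    intro n
    obtain ⟨f, K, hf, hfK⟩ := hM n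
    set f' : LipFun X := f - f.1 x₀ • oneLip X with hf'
    have hval : ∀ x, f'.1 x = f.1 x - f.1 x₀ := fun x => by simp [hf', oneLip]
    have hφ' : φ f' = φ f := by simp [hf', h1]
    have hK' : LipschitzWith K f'.1 := LipschitzWith.of_dist_le_mul fun x y => by
      rw [hval, hval, dist_sub_right]; exact hf.dist_le_mul x y
    -- For `K = 0` no rescaling is possible, but then the function is constant and `φ` vanishes on
    -- it, contrary to `hfK`.
    rcases eq_or_ne K 0 with rfl | hK
    · have : φ f' = 0 := by
        refine map_const_eq_zero h1 f' 0 fun x => ?_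
        have := hf.dist_le_mul x x₀
        rw [hval]
        rw [NNReal.coe_zero, zero_mul, Real.dist_eq] at this
        exact abs_nonpos_iff.1 this
      rw [← hφ', this] at hfK
      simp at hfK
    · have hKp : (0 : ℝ) < K := NNReal.coe_pos.2 (pos_iff_ne_zero.2 hK)
      refine ⟨(K : ℝ)⁻¹ • f', ?_, ?_, ?_⟩
      · refine LipschitzWith.of_dist_le_mul fun x y => ?_
        have := hK'.dist_le_mul x y
        simp only [Submodule.coe_smul, Pi.smul_apply]
        rw [dist_smul₀, Real.norm_of_nonneg (inv_nonneg.2 hKp.le), NNReal.coe_one, one_mul]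
        rwa [inv_mul_le_iff₀ hKp]
      · simp [hval]
      · rw [map_smul, hφ', smul_eq_mul, abs_mul, abs_of_nonneg (inv_nonneg.2 hKp.le),
          le_inv_mul_iff₀ hKp, mul_comm]
        exact hfK.le
  -- The square leaves growth after division by `n + 1`; already for `n ≥ 2` the quotient exceeds
  -- `1`.
  choose f hf hf0 hfn using fun n : ℕ => H (n * n)
  have hb : ∀ n x, |(f n).1 x| ≤ dist x x₀ := fun n x => by
    have := (hf n).dist_le_mul x x₀
    rw [hf0, Real.dist_eq, sub_zero] at this
    simpa using this
  have hlim := hφ (fun n => ((n : ℝ) + 1)⁻¹ • f n) 0 1 (fun n => ?_) (fun x => ?_)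
  · have hev := (hlim.abs.eventually_lt_const (u := 1) (by rw [map_zero, abs_zero]; exact one_pos)).and
      (eventually_ge_atTop 2)
    obtain ⟨n, hn, hn2⟩ := hev.exists
    rw [map_smul, smul_eq_mul, abs_mul, abs_of_nonneg (by positivity : (0 : ℝ) ≤ ((n : ℝ) + 1)⁻¹),
      inv_mul_lt_iff₀ (by positivity), mul_one] at hn
    have h2 := hfn n
    push_cast at h2
    have h3 : (2 : ℝ) ≤ n := by exact_mod_cast hn2
    nlinarith
  · refine LipschitzWith.of_dist_le_mul fun x y => ?_
    have := (hf n).dist_le_mul x y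
    simp only [Submodule.coe_smul, Pi.smul_apply]
    rw [dist_smul₀, Real.norm_of_nonneg (by positivity)]
    refine (mul_le_of_le_one_left dist_nonneg (inv_le_one_of_one_le₀ ?_)).trans this
    linarith [n.cast_nonneg (α := ℝ)]
  · refine squeeze_zero_norm (a := fun n : ℕ => 1 / ((n : ℝ) + 1) * dist x x₀) (fun n => ?_)
      (by simpa using (tendsto_one_div_add_atTop_nhds_zero_nat (𝕜 := ℝ)).mul_const (dist x x₀))
    simp only [Submodule.coe_smul, Pi.smul_apply]
    rw [norm_smul, Real.norm_of_nonneg (by positivity), one_div]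
    exact mul_le_mul_of_nonneg_left (hb n x) (by positivity)

/-- On a separable space the Arens-Eells space consists of the weak-* continuous functionals of zero
average. -/
theorem mem_range_toFunctional_of_isSeqWeakStarContinuous [TopologicalSpace.SeparableSpace X]
    {φ : LipFun X →ₗ[ℝ] ℝ} (h1 : φ (oneLip X) = 0) (hφ : IsSeqWeakStarContinuous φ) :
    φ ∈ range (toFunctional : AE X → LipFun X →ₗ[ℝ] ℝ) := by
  obtain ⟨M, hM⟩ := exists_bound_of_isSeqWeakStarContinuous h1 hφ
  suffices hF : ∀ ε : ℝ, 0 < ε → ∃ F : Finset X, ∀ (f : LipFun X) (K : ℝ≥0), LipschitzWith K f.1 →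
      (∀ x ∈ F, f.1 x = 0) → |φ f| ≤ ε * K by
    obtain ⟨u, hu⟩ := exists_toFunctional_eq isLipDense_id φ hM hF
    exact ⟨u, LinearMap.ext hu⟩
  rcases isEmpty_or_nonempty X with h | hne
  · exact fun ε hε => ⟨∅, fun f K _ _ => by
      rw [map_const_eq_zero h1 f 0 fun x => h.elim x, abs_zero]; positivity⟩
  intro ε hε
  classical
  set z := TopologicalSpace.denseSeq X
  by_contra! hcon
  -- The failure is applied to the first `n` points of a dense sequence. The resulting 1-Lipschitz
  -- functions tend to zero on all of `X`, since near any point there is one where they eventually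
  -- vanish; this contradicts weak-* continuity.
  have H : ∀ n : ℕ, ∃ f : LipFun X, LipschitzWith 1 f.1 ∧ (∀ i < n, f.1 (z i) = 0) ∧
      ε ≤ |φ f| := by
    intro n
    obtain ⟨f, K, hf, hf0, hfK⟩ := hcon ((Finset.range n).image z)
    rcases eq_or_ne K 0 with rfl | hK
    · have := hM f 0 hf
      simp only [NNReal.coe_zero, mul_zero] at this hfK
      linarith
    · have hKp : (0 : ℝ) < K := NNReal.coe_pos.2 (pos_iff_ne_zero.2 hK)
      refine ⟨(K : ℝ)⁻¹ • f, ?_, fun i hi => ?_, ?_⟩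
      · refine LipschitzWith.of_dist_le_mul fun x y => ?_
        have := hf.dist_le_mul x y
        simp only [Submodule.coe_smul, Pi.smul_apply]
        rw [dist_smul₀, Real.norm_of_nonneg (inv_nonneg.2 hKp.le), NNReal.coe_one, one_mul]
        rwa [inv_mul_le_iff₀ hKp]
      · have := hf0 (z i) (Finset.mem_image_of_mem _ (Finset.mem_range.2 hi))
        simp [this]
      · rw [map_smul, smul_eq_mul, abs_mul, abs_of_nonneg (inv_nonneg.2 hKp.le),
          le_inv_mul_iff₀ hKp, mul_comm]
        exact hfK.le
  choose f hf hf0 hfε using H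
  have hlim := hφ f 0 1 hf fun x => ?_
  · have := ge_of_tendsto' hlim.abs hfε
    simp only [map_zero, abs_zero] at this
    linarith
  · rw [Metric.tendsto_atTop]
    intro δ hδ
    obtain ⟨_, ⟨i, rfl⟩, hi⟩ := Metric.mem_closure_iff.1
      (TopologicalSpace.denseRange_denseSeq X x) δ hδ
    refine ⟨i + 1, fun n hn => ?_⟩
    have := (hf n).dist_le_mul x (z i)
    rw [hf0 n i (by omega), NNReal.coe_one, one_mul] at this
    exact this.trans_lt hi

end representation

/-! ### Decomposing elements of the Arens-Eells space into series -/

section filling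

variable {X : Type*} [PseudoMetricSpace X]

/-- `G v r` is to be read as "`v` has a filling of cost `r`". Keeping it abstract lets the same
argument serve rectifiable metric currents and normal Euclidean currents. A nearly optimal atomic
representation of a molecule close to `u` is filled atom by atom. -/
theorem AE.exists_approx {c : ℝ} (hc : 0 ≤ c) {G : AE X → ℝ → Prop} (h0 : G 0 0)
    (hadd : ∀ u v r s, G u r → G v s → G (u + v) (r + s))
    (hsmul : ∀ (a : ℝ) u r, G u r → G (a • u) (|a| * r))
    (hatom : ∀ (x y : X) (ε : ℝ), 0 < ε → ∃ v, ‖(atomMolecule x y : AE X) - v‖ < ε ∧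
      G v (c * dist x y)) (u : AE X) {ε : ℝ} (hε : 0 < ε) :
    ∃ v r, ‖u - v‖ < ε ∧ r ≤ c * ‖u‖ + ε ∧ G v r := by
  have hsum : ∀ (n : ℕ) (η : Fin n → ℝ) (x y : Fin n → X) (ε : ℝ), 0 < ε → ∃ v,
      ‖((∑ j, η j • atomMolecule (x j) (y j) : Molecule X) : AE X) - v‖ < ε ∧
        G v (c * ∑ j, |η j| * dist (x j) (y j)) := by
    intro n
    induction n with
    | zero => exact fun η x y ε hε => ⟨0, by simpa using hε, by simpa using h0⟩
    | succ n ih =>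
      intro η x y ε hε
      obtain ⟨v, hv, hGv⟩ := ih (fun j => η j.succ) (fun j => x j.succ) (fun j => y j.succ)
        (ε / 2) (half_pos hε)
      obtain ⟨w, hw, hGw⟩ := hatom (x 0) (y 0) (ε / (2 * (|η 0| + 1))) (by positivity)
      refine ⟨η 0 • w + v, ?_, ?_⟩
      · rw [Fin.sum_univ_succ, UniformSpace.Completion.coe_add, UniformSpace.Completion.coe_smul,
          add_sub_add_comm, ← smul_sub]
        refine (norm_add_le _ _).trans_lt ?_
        rw [norm_smul, Real.norm_eq_abs]
        have h1 : |η 0| * ‖(atomMolecule (x 0) (y 0) : AE X) - w‖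
            ≤ (|η 0| + 1) * (ε / (2 * (|η 0| + 1))) := by gcongr; linarith
        have h2 : (|η 0| + 1) * (ε / (2 * (|η 0| + 1))) = ε / 2 := by
          have : |η 0| + 1 ≠ 0 := by positivity
          field_simp
        linarith
      · rw [Fin.sum_univ_succ, mul_add]
        convert hadd _ _ _ _ (hsmul (η 0) _ _ hGw) hGv using 1
        ring
  -- The tolerance is paid twice, for the distance to `m` and for the suboptimal representation;
  -- multiplied by `c` the two add up to `ε * (c / (c + 1)) ≤ ε`.
  obtain ⟨_, ⟨m, rfl⟩, hm⟩ := Metric.mem_closure_iff.1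
    (UniformSpace.Completion.denseRange_coe (α := Molecule X) u) (ε / (2 * (c + 1)))
    (by positivity)
  rw [dist_eq_norm] at hm
  obtain ⟨r, hr, hr'⟩ := exists_lt_of_csInf_lt (atomicCosts_nonempty m)
    (lt_add_of_pos_right _ (show 0 < ε / (2 * (c + 1)) by positivity))
  rw [← Molecule.norm_def] at hr'
  obtain ⟨n, η, x, y, rfl, rfl⟩ := Molecule.exists_eq_sum_of_mem hr
  obtain ⟨v, hv, hGv⟩ := hsum n η x y (ε / 2) (half_pos hε)
  have hc1 : ε / (2 * (c + 1)) ≤ ε / 2 :=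
    div_le_div_of_nonneg_left hε.le (by norm_num) (by linarith)
  refine ⟨v, _, ?_, ?_, hGv⟩
  · calc ‖u - v‖ ≤ _ := norm_sub_le_norm_sub_add_norm_sub _ _ _
      _ < ε := by linarith
  · set m : Molecule X := ∑ j, η j • atomMolecule (x j) (y j)
    have h1 : ‖m‖ ≤ ‖u‖ + ε / (2 * (c + 1)) := by
      rw [← UniformSpace.Completion.norm_coe m]
      have := norm_sub_norm_le (m : AE X) u
      rw [norm_sub_rev] at this
      linarith
    calc c * _ ≤ c * (‖u‖ + ε / (2 * (c + 1)) + ε / (2 * (c + 1))) :=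
          mul_le_mul_of_nonneg_left (by linarith) hc
      _ = c * ‖u‖ + ε * (c / (c + 1)) := by field_simp; ring
      _ ≤ c * ‖u‖ + ε := by
        have : c / (c + 1) ≤ 1 := (div_le_one (by positivity)).2 (by linarith)
        nlinarith

/-- Every element of the Arens-Eells space is the sum of a series of fillable elements, with
control of the total cost. -/
theorem AE.exists_hasSum {c : ℝ} (hc : 0 ≤ c) {G : AE X → ℝ → Prop}
    (hnonneg : ∀ u r, G u r → 0 ≤ r) (h0 : G 0 0)
    (hadd : ∀ u v r s, G u r → G v s → G (u + v) (r + s))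
    (hsmul : ∀ (a : ℝ) u r, G u r → G (a • u) (|a| * r))
    (hatom : ∀ (x y : X) (ε : ℝ), 0 < ε → ∃ v, ‖(atomMolecule x y : AE X) - v‖ < ε ∧
      G v (c * dist x y)) (u : AE X) {ε : ℝ} (hε : 0 < ε) :
    ∃ (v : ℕ → AE X) (r : ℕ → ℝ), (∀ k, G (v k) (r k)) ∧
      (∀ f, HasSum (fun k => toFunctional (v k) f) (toFunctional u f)) ∧
      Summable r ∧ ∑' k, r k ≤ c * ‖u‖ + ε := by
  -- The first step costs at most `c * ‖u‖ + δ / 2`, and the later ones, which fill remainders of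
  -- total norm at most `δ`, cost at most `c * δ + δ / 2`.
  set δ : ℝ := ε / (2 * (c + 1)) with hδ
  have hδp : 0 < δ := by positivity
  choose! V R hV hR hG using fun (w : AE X) (e : ℝ) (he : 0 < e) =>
    AE.exists_approx hc h0 hadd hsmul hatom w he
  -- `w k` is the part of `u` that is still unfilled after `k` steps.
  let w : ℕ → AE X := fun k => Nat.rec u (fun k w => w - V w (δ / 2 / 2 ^ k)) k
  have hw : ∀ k, w (k + 1) = w k - V (w k) (δ / 2 / 2 ^ k) := fun k => rfl
  have hp : ∀ k : ℕ, 0 < δ / 2 / 2 ^ k := fun k => by positivity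
  have hwn : ∀ k, ‖w (k + 1)‖ < δ / 2 / 2 ^ k := fun k => by rw [hw]; exact hV _ _ (hp k)
  have hgeo : HasSum (fun k : ℕ => δ / 2 / 2 ^ k) δ := hasSum_geometric_two' δ
  have hGk : ∀ k, G (V (w k) (δ / 2 / 2 ^ k)) (R (w k) (δ / 2 / 2 ^ k)) := fun k => hG _ _ (hp k)
  have hRk : ∀ k, R (w (k + 1)) (δ / 2 / 2 ^ (k + 1)) ≤ c * (δ / 2 / 2 ^ k) + δ / 2 / 2 ^ (k + 1) :=
    fun k => (hR _ _ (hp _)).trans (by gcongr; exact (hwn k).le)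
  have hgeo1 : HasSum (fun k : ℕ => δ / 2 / 2 ^ (k + 1)) (δ / 2) := by
    have := hgeo.div_const 2
    refine this.congr_fun fun k => ?_
    rw [pow_succ]; field_simp
  have hb := (hgeo.mul_left c).add hgeo1
  have hRs : Summable fun k => R (w (k + 1)) (δ / 2 / 2 ^ (k + 1)) :=
    Summable.of_nonneg_of_le (fun k => hnonneg _ _ (hGk (k + 1))) hRk hb.summable
  have hRs' : Summable fun k => R (w k) (δ / 2 / 2 ^ k) :=
    (summable_nat_add_iff (f := fun k => R (w k) (δ / 2 / 2 ^ k)) 1).1 hRs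
  refine ⟨fun k => V (w k) (δ / 2 / 2 ^ k), fun k => R (w k) (δ / 2 / 2 ^ k), hGk, fun f => ?_,
    hRs', ?_⟩
  · have hpart : ∀ n, ∑ k ∈ Finset.range n, V (w k) (δ / 2 / 2 ^ k) = u - w n := by
      intro n
      induction n with
      | zero => simp [w]
      | succ n ih => rw [Finset.sum_range_succ, ih, hw]; abel
    obtain ⟨K, hK⟩ := f.2
    have hsummable : Summable fun k => toFunctional (V (w k) (δ / 2 / 2 ^ k)) f := by
      refine (summable_nat_add_iff 1).1 (Summable.of_norm_bounded
        (g := fun k : ℕ => K * (2 * (δ / 2 / 2 ^ k))) ((hgeo.summable.mul_left 2).mul_left _)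
        fun k => ?_)
      refine (abs_toFunctional_le _ hK).trans (mul_le_mul_of_nonneg_left ?_ K.2)
      have e : V (w (k + 1)) (δ / 2 / 2 ^ (k + 1)) = w (k + 1) - w (k + 2) := by rw [hw (k + 1)]; abel
      rw [e]
      refine (norm_sub_le _ _).trans ?_
      have h2 : δ / 2 / 2 ^ (k + 1) ≤ δ / 2 / 2 ^ k := by
        gcongr
        · norm_num
        · exact Nat.le_succ k
      linarith [hwn k, hwn (k + 1)]
    rw [hsummable.hasSum_iff_tendsto_nat]
    have e : ∀ n, ∑ k ∈ Finset.range n, toFunctional (V (w k) (δ / 2 / 2 ^ k)) f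
        = toFunctional (u - w n) f := by
      intro n
      rw [← hpart, ← toFunctionalLM_apply, map_sum, LinearMap.sum_apply]
      rfl
    simp only [e]
    have hw0 : Tendsto w atTop (𝓝 0) := by
      rw [← tendsto_add_atTop_iff_nat 1]
      exact squeeze_zero_norm (fun k => (hwn k).le) hgeo.summable.tendsto_atTop_zero
    have := ((continuous_toFunctional f).tendsto (u - 0)).comp (hw0.const_sub u)
    rwa [sub_zero] at this
  · rw [hRs'.tsum_eq_zero_add]
    have h1 := hRs.tsum_le_tsum hRk hb.summable
    rw [hb.tsum_eq] at h1
    have h2 : R (w 0) (δ / 2 / 2 ^ 0) ≤ c * ‖u‖ + δ / 2 := by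
      have := hR (w 0) _ (hp 0)
      simpa [w] using this
    have h3 : c * δ + δ / 2 + δ / 2 ≤ ε := by
      have : (c + 1) * δ = ε / 2 := by rw [hδ]; field_simp
      nlinarith
    linarith

end filling

/-! ### The current induced by a Lipschitz curve -/

/-- Where the derivative is nonzero, `h` expands distances near the point by a definite factor.
Hence the set is covered by countably many `S k`, on whose small pieces `h` is antilipschitz, and
such a piece is null because its image is. -/
theorem volume_setOf_deriv_ne_zero {h : ℝ → ℝ} {A : Set ℝ} (hA : volume (h '' A) = 0) :
    volume {t | t ∈ A ∧ DifferentiableAt ℝ h t ∧ deriv h t ≠ 0} = 0 := by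
  let S : ℕ → Set ℝ := fun k =>
    {t | t ∈ A ∧ ∀ s, |s - t| < 1 / (k + 1 : ℝ) → |s - t| ≤ (k + 1 : ℝ) * |h s - h t|}
  have hsub : {t | t ∈ A ∧ DifferentiableAt ℝ h t ∧ deriv h t ≠ 0} ⊆ ⋃ k, S k := by
    rintro t ⟨htA, hd, hne⟩
    -- A nonzero derivative makes `h s - h t` and `s - t` comparable as `s → t`, which yields the
    -- reverse inequality needed for `S k`.
    obtain ⟨C, hC, hb⟩ := (hd.hasDerivAt.isTheta_sub hne).2.exists_pos
    have hb' := hb.bound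
    rw [prod_pure, eventually_map] at hb'
    obtain ⟨δ, hδ, hδ'⟩ := Metric.eventually_nhds_iff.1 hb'
    obtain ⟨k, hk⟩ := exists_nat_gt (max C (1 / δ))
    have hk1 : C < k := (le_max_left _ _).trans_lt hk
    have hk2 : 1 / δ < k := (le_max_right _ _).trans_lt hk
    refine mem_iUnion.2 ⟨k, htA, fun s hs => ?_⟩
    have h1 : (1 : ℝ) / (k + 1) < δ := by
      rw [div_lt_iff₀ hδ] at hk2
      rw [div_lt_iff₀ (by positivity)]
      nlinarith
    have h2 := hδ' (y := s) (by rw [Real.dist_eq]; exact hs.trans h1)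
    simp only [Real.norm_eq_abs] at h2
    nlinarith [abs_nonneg (h s - h t)]
  refine measure_mono_null hsub (measure_iUnion_null fun k => ?_)
  refine measure_null_of_locally_null _ fun t _ => ?_
  have hr : (0 : ℝ) < 1 / (k + 1) / 2 := by positivity
  set u := S k ∩ Metric.ball t (1 / (k + 1) / 2) with hu
  refine ⟨u, inter_mem self_mem_nhdsWithin (mem_nhdsWithin_of_mem_nhds (Metric.ball_mem_nhds t hr)),
    ?_⟩
  have hanti : AntilipschitzWith (k + 1 : ℝ≥0) (u.domRestrict h) := by
    refine AntilipschitzWith.of_le_mul_dist fun x y => ?_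
    have hx := x.2.2
    have hy := y.2.2
    rw [Metric.mem_ball, Real.dist_eq] at hx hy
    have hlt : |(x : ℝ) - y| < 1 / (k + 1) := by
      calc |(x : ℝ) - y| = |((x : ℝ) - t) - (y - t)| := by congr 1; ring
        _ ≤ _ := abs_sub _ _
        _ < 1 / (k + 1) := by linarith
    have := y.2.1.2 x hlt
    simpa [Subtype.dist_eq, Real.dist_eq, domRestrict_apply] using this
  have h1 := hanti.le_hausdorffMeasure_image (d := 1) zero_le_one univ
  have h2 : μH[1] (u.domRestrict h '' univ) = 0 := by
    rw [hausdorffMeasure_real, image_univ, range_domRestrict]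
    exact measure_mono_null (image_mono fun x hx => hx.1.1) hA
  rw [h2, mul_zero] at h1
  have h3 := (isometry_subtype_coe (s := u)).hausdorffMeasure_image (d := 1) (Or.inl zero_le_one)
    univ
  rw [image_univ, Subtype.range_coe, hausdorffMeasure_real] at h3
  rw [h3]
  exact le_antisymm h1 zero_le

theorem intervalIntegrable_mul_deriv {C : ℝ≥0} {f g : ℝ → ℝ} (hf : Continuous f)
    (hg : LipschitzWith C g) (a b : ℝ) : IntervalIntegrable (fun t => f t * deriv g t) volume a b :=
  (hg.lipschitzOnWith.absolutelyContinuousOnInterval.intervalIntegrable_deriv).continuousOn_mul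
    hf.continuousOn

theorem intervalIntegral_deriv_eq_sub {C : ℝ≥0} {g : ℝ → ℝ} (hg : LipschitzWith C g)
    (a b : ℝ) : ∫ t in a..b, deriv g t = g b - g a :=
  hg.lipschitzOnWith.absolutelyContinuousOnInterval.integral_deriv_eq_sub

theorem exists_lipschitzWith_comp {X : Type*} [PseudoMetricSpace X] (π : LipFun X)
    {θ : ℝ → X} {K : ℝ≥0} (hθ : LipschitzWith K θ) :
    ∃ C : ℝ≥0, LipschitzWith C fun s => π.1 (θ s) := by
  obtain ⟨C, hC⟩ := π.2
  exact ⟨C * K, hC.comp hθ⟩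

section curveCurrent

variable {X : Type*} [MetricSpace X]

theorem continuous_of_mem_bddLipFun (f : BddLipFun X) : Continuous f.1 := by
  obtain ⟨⟨C, hC⟩, -⟩ := f.2
  exact hC.continuous

theorem continuous_comp_curve (f : BddLipFun X) {θ : ℝ → X} {K : ℝ≥0} (hθ : LipschitzWith K θ) :
    Continuous fun s => f.1 (θ s) :=
  (continuous_of_mem_bddLipFun f).comp hθ.continuous

/-- The current `(f, π) ↦ ∫_0^1 f(θ(t)) (π ∘ θ)'(t) dt` induced by a Lipschitz curve. -/
def curveCurrent (θ : ℝ → X) {K : ℝ≥0} (hθ : LipschitzWith K θ) :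
    BddLipFun X →ₗ[ℝ] LipFun X →ₗ[ℝ] ℝ :=
  LinearMap.mk₂ ℝ (fun f π => ∫ t in (0 : ℝ)..1, f.1 (θ t) * deriv (fun s => π.1 (θ s)) t)
    (fun f g π => by
      obtain ⟨C, hC⟩ := exists_lipschitzWith_comp π hθ
      rw [← intervalIntegral.integral_add
        (intervalIntegrable_mul_deriv (continuous_comp_curve f hθ) hC 0 1)
        (intervalIntegrable_mul_deriv (continuous_comp_curve g hθ) hC 0 1)]
      exact intervalIntegral.integral_congr fun t _ => add_mul _ _ _)
    (fun c f π => by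
      rw [smul_eq_mul, ← intervalIntegral.integral_const_mul]
      exact intervalIntegral.integral_congr fun t _ => mul_assoc _ _ _)
    (fun f π ρ => by
      obtain ⟨C, hC⟩ := exists_lipschitzWith_comp π hθ
      obtain ⟨D, hD⟩ := exists_lipschitzWith_comp ρ hθ
      rw [← intervalIntegral.integral_add
        (intervalIntegrable_mul_deriv (continuous_comp_curve f hθ) hC 0 1)
        (intervalIntegrable_mul_deriv (continuous_comp_curve f hθ) hD 0 1)]
      refine intervalIntegral.integral_congr_ae ?_
      filter_upwards [hC.ae_differentiableAt_real, hD.ae_differentiableAt_real] with t h1 h2 _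
      have : deriv (fun s => (π + ρ).1 (θ s)) t
          = deriv (fun s => π.1 (θ s)) t + deriv (fun s => ρ.1 (θ s)) t := deriv_add h1 h2
      rw [this, mul_add])
    (fun c f π => by
      obtain ⟨C, hC⟩ := exists_lipschitzWith_comp π hθ
      rw [smul_eq_mul, ← intervalIntegral.integral_const_mul]
      refine intervalIntegral.integral_congr_ae ?_
      filter_upwards [hC.ae_differentiableAt_real] with t h1 _
      have : deriv (fun s => (c • π).1 (θ s)) t = c * deriv (fun s => π.1 (θ s)) t :=
        deriv_const_mul c h1
      rw [this]
      ring)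

variable {θ : ℝ → X} {K : ℝ≥0}

theorem curveCurrent_apply (hθ : LipschitzWith K θ) (f : BddLipFun X) (π : LipFun X) :
    curveCurrent θ hθ f π
      = ∫ t in (0 : ℝ)..1, f.1 (θ t) * deriv (fun s => π.1 (θ s)) t := rfl

theorem boundary_curveCurrent (hθ : LipschitzWith K θ) (π : LipFun X) :
    boundary (curveCurrent θ hθ) π = π.1 (θ 1) - π.1 (θ 0) := by
  obtain ⟨C, hC⟩ := exists_lipschitzWith_comp π hθ
  rw [← intervalIntegral_deriv_eq_sub hC]
  exact intervalIntegral.integral_congr fun t _ => one_mul _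

/-- Pointwise convergence says nothing about the derivatives of `π_j ∘ θ`, so integration by parts
moves the derivative to `f ∘ θ`. Dominated convergence then applies to the values. -/
theorem isSeqWeakStarContinuous_curveCurrent (hθ : LipschitzWith K θ) (f : BddLipFun X) :
    IsSeqWeakStarContinuous (curveCurrent θ hθ f) := by
  intro π ρ L hπ hlim
  obtain ⟨⟨D, hD⟩, -⟩ := f.2
  have hF : LipschitzWith (D * K) fun s => f.1 (θ s) := hD.comp hθ
  have hF' := hF.lipschitzOnWith (s := uIcc 0 1) |>.absolutelyContinuousOnInterval
  have ibp : ∀ σ : LipFun X, curveCurrent θ hθ f σ = f.1 (θ 1) * σ.1 (θ 1) - f.1 (θ 0) * σ.1 (θ 0)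
      - ∫ t in (0 : ℝ)..1, deriv (fun s => f.1 (θ s)) t * σ.1 (θ t) := by
    intro σ
    obtain ⟨C, hC⟩ := exists_lipschitzWith_comp σ hθ
    exact hF'.integral_mul_deriv_eq_deriv_mul
      hC.lipschitzOnWith.absolutelyContinuousOnInterval
  simp only [ibp]
  refine (((hlim _).const_mul _).sub ((hlim _).const_mul _)).sub ?_
  obtain ⟨B, hB⟩ := ((hlim (θ 0)).norm.bddAbove_range)
  -- Convergence at the single point `θ 0` bounds the values there; the common Lipschitz constant
  -- extends the bound along the curve.
  have hB' : ∀ j t, t ∈ Ioc (0 : ℝ) 1 → |(π j).1 (θ t)| ≤ B + L * K := by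
    intro j t ht
    have h1 : |(π j).1 (θ 0)| ≤ B := hB (mem_range_self j)
    have h2 := ((hπ j).comp hθ).dist_le_mul t 0
    rw [Real.dist_eq, Real.dist_eq, sub_zero, abs_of_pos ht.1] at h2
    have h3 : ((L * K : ℝ≥0) : ℝ) * t ≤ L * K := by
      push_cast
      exact mul_le_of_le_one_right (by positivity) ht.2
    have h4 := abs_sub_abs_le_abs_sub ((π j).1 (θ t)) ((π j).1 (θ 0))
    simp only [Function.comp_apply] at h2
    linarith
  refine intervalIntegral.tendsto_integral_filter_of_dominated_convergence
    (fun _ => (D * K : ℝ≥0) * (B + L * K)) (Eventually.of_forall fun j => ?_)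
    (Eventually.of_forall fun j => Eventually.of_forall fun t ht => ?_)
    intervalIntegrable_const (Eventually.of_forall fun t _ => (hlim _).const_mul _)
  · exact ((measurable_deriv _).mul
      ((hπ j).continuous.comp hθ.continuous).measurable).aestronglyMeasurable
  · rw [uIoc_of_le zero_le_one] at ht
    rw [norm_mul]
    exact mul_le_mul (norm_deriv_le_of_lipschitz hF) (hB' j t ht) (norm_nonneg _) (by positivity)

theorem curveCurrent_locality (hθ : LipschitzWith K θ) (f : BddLipFun X) (π : LipFun X)
    (h : ∃ U : Set X, IsOpen U ∧ tsupport f.1 ⊆ U ∧ ∃ c : ℝ, ∀ x ∈ U, π.1 x = c) :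
    curveCurrent θ hθ f π = 0 := by
  obtain ⟨U, hU, hfU, c, hc⟩ := h
  rw [curveCurrent_apply]
  refine (intervalIntegral.integral_congr fun t _ => ?_).trans intervalIntegral.integral_zero
  by_cases ht : θ t ∈ tsupport f.1
  · have : (fun s => π.1 (θ s)) =ᶠ[𝓝 t] fun _ => c := by
      filter_upwards [hθ.continuous.continuousAt.preimage_mem_nhds (hU.mem_nhds (hfU ht))] with s hs
      exact hc _ hs
    simp only [this.deriv_eq, deriv_const, mul_zero]
  · simp only [image_eq_zero_of_notMem_tsupport ht, zero_mul]

/-- The speed of a curve, computed from the distances to a sequence of points. -/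
def curveSpeed (z : ℕ → X) (θ : ℝ → X) (t : ℝ) : ℝ≥0∞ :=
  ⨆ n, ‖deriv (fun s => dist (z n) (θ s)) t‖ₑ

theorem measurable_curveSpeed (z : ℕ → X) (θ : ℝ → X) : Measurable (curveSpeed z θ) :=
  Measurable.iSup fun _ => (measurable_deriv _).enorm

theorem lipschitzWith_dist_comp (hθ : LipschitzWith K θ) (x : X) : LipschitzWith K fun s => dist x (θ s) := by
  simpa [Function.comp_def] using (LipschitzWith.dist_right x).comp hθ

theorem curveSpeed_le (hθ : LipschitzWith K θ) (z : ℕ → X) (t : ℝ) : curveSpeed z θ t ≤ K := by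
  refine iSup_le fun n => ?_
  have := norm_deriv_le_of_lipschitz (x₀ := t) (lipschitzWith_dist_comp hθ (z n))
  rw [← ofReal_norm]
  exact (ENNReal.ofReal_le_ofReal this).trans (by simp)

theorem curveSpeed_ne_top (hθ : LipschitzWith K θ) (z : ℕ → X) (t : ℝ) : curveSpeed z θ t ≠ ∞ :=
  ((curveSpeed_le hθ z t).trans_lt ENNReal.coe_lt_top).ne

theorem locallyIntegrable_curveSpeed (hθ : LipschitzWith K θ) (z : ℕ → X) :
    LocallyIntegrable (fun t => (curveSpeed z θ t).toReal) volume := by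
  refine (locallyIntegrable_const (K : ℝ)).mono
    (measurable_curveSpeed z θ).ennreal_toReal.aestronglyMeasurable
    (Eventually.of_forall fun t => ?_)
  rw [Real.norm_of_nonneg ENNReal.toReal_nonneg, Real.norm_of_nonneg (NNReal.coe_nonneg K)]
  exact ENNReal.toReal_le_coe_of_le_coe (curveSpeed_le hθ z t)

theorem abs_deriv_dist_le (hθ : LipschitzWith K θ) (z : ℕ → X) (n : ℕ) (t : ℝ) :
    |deriv (fun s => dist (z n) (θ s)) t| ≤ (curveSpeed z θ t).toReal := by
  have := ENNReal.toReal_mono (curveSpeed_ne_top hθ z t)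
    (le_iSup (fun n => ‖deriv (fun s => dist (z n) (θ s)) t‖ₑ) n)
  simpa using this

/-- If `z n` is close to `θ b`, the distance to `z n` changes along the curve by almost `dist (θ a)
(θ b)`, and its derivative is bounded by the speed. -/
theorem dist_le_integral_curveSpeed (hθ : LipschitzWith K θ) {z : ℕ → X} (hz : DenseRange z) {a b : ℝ} (hab : a ≤ b) :
    dist (θ a) (θ b) ≤ ∫ t in a..b, (curveSpeed z θ t).toReal := by
  refine le_of_forall_pos_le_add fun ε hε => ?_
  obtain ⟨_, ⟨n, rfl⟩, hn⟩ := Metric.mem_closure_iff.1 (hz (θ b)) (ε / 2) (half_pos hε)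
  have hg := lipschitzWith_dist_comp hθ (z n)
  have h1 := intervalIntegral_deriv_eq_sub hg a b
  have h2 : |∫ t in a..b, deriv (fun s => dist (z n) (θ s)) t|
      ≤ ∫ t in a..b, (curveSpeed z θ t).toReal := by
    refine (intervalIntegral.abs_integral_le_integral_abs hab).trans ?_
    refine intervalIntegral.integral_mono_on hab
      (hg.lipschitzOnWith.absolutelyContinuousOnInterval.intervalIntegrable_deriv).abs
      ((locallyIntegrable_curveSpeed hθ z).integrableOn_isCompact isCompact_uIcc
        |>.mono_set uIoc_subset_uIcc |> intervalIntegrable_iff.2) fun t _ => abs_deriv_dist_le hθ z n t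
  rw [h1] at h2
  have h3 := neg_abs_le (dist (z n) (θ b) - dist (z n) (θ a))
  have h4 := dist_triangle_left (θ a) (θ b) (z n)
  rw [dist_comm] at hn
  linarith

/-- The exceptional null set does not depend on `π`: it is where the indefinite integral of the
speed fails to have the speed as derivative. Elsewhere, difference quotients of `π ∘ θ` are at most
`L` times the averages of the speed. -/
theorem ae_abs_deriv_comp_le (hθ : LipschitzWith K θ) {z : ℕ → X} (hz : DenseRange z) :
    ∀ᵐ t : ℝ, ∀ (π : X → ℝ) (L : ℝ≥0), LipschitzWith L π →
      |deriv (fun s => π (θ s)) t| ≤ L * (curveSpeed z θ t).toReal := by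
  have hli := locallyIntegrable_curveSpeed hθ z
  have hint : ∀ a b, IntervalIntegrable (fun t => (curveSpeed z θ t).toReal) volume a b :=
    fun a b => intervalIntegrable_iff.2
      ((hli.integrableOn_isCompact isCompact_uIcc).mono_set uIoc_subset_uIcc)
  filter_upwards [LocallyIntegrable.ae_hasDerivAt_integral hli] with t ht π L hπ
  -- Without differentiability `deriv` takes its default value `0`, and the bound is trivial.
  by_cases hd : DifferentiableAt ℝ (fun s => π (θ s)) t
  swap
  · rw [deriv_zero_of_not_differentiableAt hd, abs_zero]
    positivity
  have h1 := (hasDerivAt_iff_tendsto_slope_zero.1 hd.hasDerivAt).mono_left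
    (nhdsGT_le_nhdsNE 0)
  have h2 := (hasDerivAt_iff_tendsto_slope_zero.1 (ht t)).mono_left
    (nhdsGT_le_nhdsNE 0)
  refine le_of_tendsto_of_tendsto h1.abs (h2.const_mul (L : ℝ)) ?_
  filter_upwards [self_mem_nhdsWithin] with s (hs : 0 < s)
  have h3 : |π (θ (t + s)) - π (θ t)| ≤ L * ∫ r in t..(t + s), (curveSpeed z θ r).toReal := by
    have := hπ.dist_le_mul (θ t) (θ (t + s))
    rw [dist_comm, Real.dist_eq] at this
    exact this.trans (mul_le_mul_of_nonneg_left
      (dist_le_integral_curveSpeed hθ hz (by linarith)) L.2)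
  rw [intervalIntegral.integral_same, sub_zero, smul_eq_mul, smul_eq_mul, abs_mul,
    abs_of_pos (inv_pos.2 hs), mul_left_comm]
  exact mul_le_mul_of_nonneg_left h3 (inv_nonneg.2 hs.le)

/-- Distance functions are 1-Lipschitz, so their right difference quotients along the curve are at
most those defining the metric speed. The second curve `θ'` appears because the given curve is
Lipschitz only on `[0, 1]`, while `θ` is a global Lipschitz extension. -/
theorem ae_curveSpeed_le_metricSpeed (hθ : LipschitzWith K θ) (z : ℕ → X) {θ' : ℝ → X} (h : EqOn θ θ' (Icc 0 1)) :
    ∀ᵐ t : ℝ, t ∈ Ioo (0 : ℝ) 1 → curveSpeed z θ t ≤ metricSpeed θ' t := by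
  have hd : ∀ᵐ t : ℝ, ∀ n, DifferentiableAt ℝ (fun s => dist (z n) (θ s)) t :=
    ae_all_iff.2 fun n => (lipschitzWith_dist_comp hθ (z n)).ae_differentiableAt_real
  filter_upwards [hd] with t ht htI
  refine iSup_le fun n => ?_
  have h1 := ((hasDerivAt_iff_tendsto_slope_zero.1 (ht n).hasDerivAt).mono_left
    (nhdsGT_le_nhdsNE 0)).enorm
  rw [← h1.limsup_eq]
  refine limsup_le_limsup ?_
  have hI : Ioo (0 : ℝ) (1 - t) ∈ 𝓝[>] (0 : ℝ) := Ioo_mem_nhdsGT (by linarith [htI.2])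
  filter_upwards [hI] with s hs
  rw [← h ⟨by linarith [htI.1, hs.1], by linarith [hs.2]⟩, ← h ⟨htI.1.le, htI.2.le⟩,
    ← ofReal_norm]
  refine ENNReal.ofReal_le_ofReal ?_
  rw [norm_smul, Real.norm_of_nonneg (inv_nonneg.2 hs.1.le), inv_mul_eq_div]
  refine div_le_div_of_nonneg_right ?_ hs.1.le
  rw [Real.norm_eq_abs, dist_comm (z n), dist_comm (z n)]
  exact abs_dist_sub_le _ _ _

theorem isOneRectifiableSet_image (hθ : LipschitzWith K θ) :
    IsOneRectifiableSet (θ '' Icc (0 : ℝ) 1) :=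
  ⟨Icc 0 1, (Icc (0 : ℝ) 1).domRestrict θ, K, Metric.isBounded_Icc 0 1,
    hθ.lipschitzOnWith.to_restrict, range_domRestrict _ _⟩

variable [MeasurableSpace X]

/-- The image of the arc length measure of a curve. -/
def curveMeasure (z : ℕ → X) (θ : ℝ → X) : Measure X :=
  ((volume.restrict (Ioc (0 : ℝ) 1)).withDensity (curveSpeed z θ)).map θ

variable [BorelSpace X]

theorem curveMeasure_apply (hθ : LipschitzWith K θ) (z : ℕ → X) {s : Set X} (hs : MeasurableSet s) :
    curveMeasure z θ s = ∫⁻ t in θ ⁻¹' s ∩ Ioc 0 1, curveSpeed z θ t := by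
  have hm : MeasurableSet (θ ⁻¹' s) := hθ.continuous.measurable hs
  rw [curveMeasure, Measure.map_apply hθ.continuous.measurable hs, withDensity_apply _ hm,
    Measure.restrict_restrict hm]

theorem curveMeasure_univ_le (hθ : LipschitzWith K θ) (z : ℕ → X) {θ' : ℝ → X} (h : EqOn θ θ' (Icc 0 1)) :
    curveMeasure z θ univ ≤ curveLength θ' := by
  rw [curveMeasure_apply hθ z MeasurableSet.univ, preimage_univ, univ_inter, curveLength,
    setLIntegral_congr (Ioo_ae_eq_Ioc (a := (0 : ℝ)) (b := 1)).symm]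
  exact setLIntegral_mono_ae' measurableSet_Ioo (ae_curveSpeed_le_metricSpeed hθ z h)

theorem isFiniteMeasure_curveMeasure (hθ : LipschitzWith K θ) (z : ℕ → X) : IsFiniteMeasure (curveMeasure z θ) := by
  refine ⟨?_⟩
  rw [curveMeasure_apply hθ z MeasurableSet.univ, preimage_univ, univ_inter]
  refine (lintegral_mono fun t => curveSpeed_le hθ z t).trans_lt ?_
  simp

theorem isMassBound_curveMeasure (hθ : LipschitzWith K θ) {z : ℕ → X} (hz : DenseRange z) :
    IsMassBound (curveCurrent θ hθ) (curveMeasure z θ) := by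
  refine ⟨isFiniteMeasure_curveMeasure hθ z, fun f π L hπ => ?_⟩
  have hint : ∫ x, |f.1 x| ∂(curveMeasure z θ)
      = ∫ t in (0 : ℝ)..1, (curveSpeed z θ t).toReal * |f.1 (θ t)| := by
    rw [curveMeasure, integral_map hθ.continuous.aemeasurable
      (continuous_of_mem_bddLipFun f).abs.measurable.aestronglyMeasurable,
      integral_withDensity_eq_integral_toReal_smul (measurable_curveSpeed z θ)
        (Eventually.of_forall fun t => (curveSpeed_ne_top hθ z t).lt_top),
      intervalIntegral.integral_of_le zero_le_one]
    rfl
  have hI : IntervalIntegrable (fun t => (curveSpeed z θ t).toReal * |f.1 (θ t)|) volume 0 1 :=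
    ((intervalIntegrable_iff.2 (((locallyIntegrable_curveSpeed hθ z).integrableOn_isCompact
      isCompact_uIcc).mono_set uIoc_subset_uIcc)).mul_continuousOn
      (continuous_comp_curve f hθ).abs.continuousOn)
  rw [hint, ← intervalIntegral.integral_const_mul, curveCurrent_apply]
  refine (intervalIntegral.abs_integral_le_integral_abs zero_le_one).trans ?_
  obtain ⟨C, hC⟩ := exists_lipschitzWith_comp π hθ
  refine intervalIntegral.integral_mono_ae zero_le_one
    (intervalIntegrable_mul_deriv (continuous_comp_curve f hθ) hC 0 1).abs
    (hI.const_mul _) ?_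
  filter_upwards [ae_abs_deriv_comp_le hθ hz] with t ht
  rw [abs_mul, ← mul_assoc, mul_comm]
  exact mul_le_mul_of_nonneg_right (ht π.1 L hπ) (abs_nonneg _)

/-- Distance functions map an `ℋ¹`-null set to Lebesgue null sets. By `volume_setOf_deriv_ne_zero`
their derivatives along the curve vanish almost everywhere on its preimage, and so does the speed,
which is their supremum. -/
theorem curveMeasure_absolutelyContinuous (hθ : LipschitzWith K θ) (z : ℕ → X) :
    curveMeasure z θ ≪ Measure.hausdorffMeasure (1 : ℝ) := by
  refine Measure.AbsolutelyContinuous.mk fun s hs h0 => ?_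
  rw [curveMeasure_apply hθ z hs, lintegral_eq_zero_iff (measurable_curveSpeed z θ)]
  have hm : MeasurableSet (θ ⁻¹' s ∩ Ioc (0 : ℝ) 1) :=
    (hθ.continuous.measurable hs).inter measurableSet_Ioc
  rw [Filter.EventuallyEq, ae_restrict_iff' hm]
  have H : ∀ n, ∀ᵐ t : ℝ, t ∈ θ ⁻¹' s → deriv (fun s => dist (z n) (θ s)) t = 0 := by
    intro n
    have himg : volume ((fun s => dist (z n) (θ s)) '' (θ ⁻¹' s)) = 0 := by
      have h1 := (LipschitzWith.dist_right (z n)).hausdorffMeasure_image_le zero_le_one s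
      rw [h0, mul_zero, hausdorffMeasure_real] at h1
      refine measure_mono_null ?_ (le_antisymm h1 zero_le)
      rintro _ ⟨t, ht, rfl⟩
      exact ⟨θ t, ht, rfl⟩
    filter_upwards [measure_eq_zero_iff_ae_notMem.1 (volume_setOf_deriv_ne_zero himg),
      (lipschitzWith_dist_comp hθ (z n)).ae_differentiableAt_real] with t ht hd hts
    by_contra hne
    exact ht ⟨hts, hd, hne⟩
  filter_upwards [ae_all_iff.2 H] with t ht hts
  simp [curveSpeed, fun n => ht n hts.1]

theorem curveMeasure_compl_image (hθ : LipschitzWith K θ) (z : ℕ → X) : curveMeasure z θ (θ '' Icc (0 : ℝ) 1)ᶜ = 0 := by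
  have hc : MeasurableSet (θ '' Icc (0 : ℝ) 1) :=
    (isCompact_Icc.image hθ.continuous).isClosed.measurableSet
  rw [curveMeasure_apply hθ z hc.compl]
  have : θ ⁻¹' (θ '' Icc (0 : ℝ) 1)ᶜ ∩ Ioc 0 1 = ∅ := by
    ext t
    simp only [mem_inter_iff, mem_preimage, mem_compl_iff, mem_empty_iff_false, iff_false]
    exact fun h => h.1 ⟨t, Ioc_subset_Icc_self h.2, rfl⟩
  rw [this]
  simp

end curveCurrent

/-! ### Rectifiable currents and series of currents -/

section rectifiable

variable {X : Type*} [MetricSpace X] [MeasurableSpace X] [BorelSpace X]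

theorem integrable_abs_of_mem_bddLipFun (f : BddLipFun X) (μ : Measure X) [IsFiniteMeasure μ] :
    Integrable (fun x => |f.1 x|) μ := by
  obtain ⟨-, C, hC⟩ := f.2
  exact Integrable.of_bound (continuous_of_mem_bddLipFun f).abs.measurable.aestronglyMeasurable C
    (Eventually.of_forall fun x => by simpa using hC x)

/-- `T` is a metric current with mass bound `μ`, where `μ` is rectifiable. -/
structure IsRectifiableWith (T : BddLipFun X →ₗ[ℝ] LipFun X →ₗ[ℝ] ℝ) (μ : Measure X) : Prop where
  isMassBound : IsMassBound T μ
  continuity : ∀ f : BddLipFun X, IsSeqWeakStarContinuous (T f)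
  locality : ∀ (f : BddLipFun X) (π : LipFun X),
    (∃ U : Set X, IsOpen U ∧ tsupport f.1 ⊆ U ∧ ∃ c : ℝ, ∀ x ∈ U, π.1 x = c) → T f π = 0
  concentrated : ∃ S : Set (Set X), S.Countable ∧ (∀ E ∈ S, IsOneRectifiableSet E) ∧ μ (⋃₀ S)ᶜ = 0
  absolutelyContinuous : μ ≪ Measure.hausdorffMeasure (1 : ℝ)

namespace IsRectifiableWith

variable {T T' : BddLipFun X →ₗ[ℝ] LipFun X →ₗ[ℝ] ℝ} {μ μ' : Measure X}

theorem isMetricCurrent (h : IsRectifiableWith T μ) : IsMetricCurrent T :=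
  ⟨⟨μ, h.isMassBound⟩, h.continuity, h.locality⟩

theorem massMeasure_le (h : IsRectifiableWith T μ) : massMeasure T ≤ μ := sInf_le h.isMassBound

theorem isRectifiable (h : IsRectifiableWith T μ) : IsRectifiable T := by
  refine ⟨?_, (Measure.absolutelyContinuous_of_le h.massMeasure_le).trans h.absolutelyContinuous⟩
  obtain ⟨S, hS, hrect, hμ⟩ := h.concentrated
  -- Inserting `∅`, the image of the empty subset of the line, makes the countable family nonempty,
  -- so that it can be listed as a sequence.
  obtain ⟨E, hE⟩ := (hS.insert ∅).exists_eq_range (insert_nonempty _ _)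
  refine ⟨E, fun n => ?_, ?_⟩
  · have : E n ∈ insert ∅ S := hE ▸ mem_range_self n
    rcases this with h | h
    · rw [h]
      exact ⟨∅, fun x => x.2.elim, 0, Bornology.isBounded_empty, fun x => x.2.elim,
        range_eq_empty _⟩
    · exact hrect _ h
  · rw [← sUnion_range, ← hE, sUnion_insert, empty_union]
    exact le_antisymm ((h.massMeasure_le _).trans hμ.le) zero_le

theorem zero : IsRectifiableWith (0 : BddLipFun X →ₗ[ℝ] LipFun X →ₗ[ℝ] ℝ) (0 : Measure X) where
  isMassBound := ⟨inferInstance, fun f π K _ => by simp⟩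
  continuity f := fun π ρ K _ _ => by simp
  locality f π _ := rfl
  concentrated := ⟨∅, countable_empty, fun E hE => hE.elim, rfl⟩
  absolutelyContinuous := Measure.AbsolutelyContinuous.zero _

theorem add (h : IsRectifiableWith T μ) (h' : IsRectifiableWith T' μ') :
    IsRectifiableWith (T + T') (μ + μ') where
  isMassBound := by
    have := h.isMassBound.1
    have := h'.isMassBound.1
    refine ⟨inferInstance, fun f π K hπ => ?_⟩
    rw [integral_add_measure (integrable_abs_of_mem_bddLipFun f μ)
      (integrable_abs_of_mem_bddLipFun f μ'), mul_add]
    exact (abs_add_le _ _).trans (add_le_add (h.isMassBound.2 f π K hπ) (h'.isMassBound.2 f π K hπ))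
  continuity f := fun π ρ K hπ hlim =>
    (h.continuity f π ρ K hπ hlim).add (h'.continuity f π ρ K hπ hlim)
  locality f π hU := by
    rw [LinearMap.add_apply, LinearMap.add_apply, h.locality f π hU, h'.locality f π hU, add_zero]
  concentrated := by
    obtain ⟨S, hS, hrect, hμ⟩ := h.concentrated
    obtain ⟨S', hS', hrect', hμ'⟩ := h'.concentrated
    refine ⟨S ∪ S', hS.union hS', fun E hE => hE.elim (hrect E) (hrect' E), ?_⟩
    rw [sUnion_union, compl_union, Measure.add_apply,
      measure_mono_null inter_subset_left hμ, measure_mono_null inter_subset_right hμ', add_zero]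
  absolutelyContinuous := Measure.AbsolutelyContinuous.mk fun s _ hs => by
    rw [Measure.add_apply, h.absolutelyContinuous hs, h'.absolutelyContinuous hs, add_zero]

theorem smul (c : ℝ) (h : IsRectifiableWith T μ) :
    IsRectifiableWith (c • T) (ENNReal.ofReal |c| • μ) where
  isMassBound := by
    have := h.isMassBound.1
    refine ⟨Measure.smul_finite μ ENNReal.ofReal_ne_top, fun f π K hπ => ?_⟩
    rw [integral_smul_measure, ENNReal.toReal_ofReal (abs_nonneg c), smul_eq_mul,
      LinearMap.smul_apply, LinearMap.smul_apply, smul_eq_mul, abs_mul, mul_left_comm]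
    exact mul_le_mul_of_nonneg_left (h.isMassBound.2 f π K hπ) (abs_nonneg c)
  continuity f := fun π ρ K hπ hlim => (h.continuity f π ρ K hπ hlim).const_smul c
  locality f π hU := by
    rw [LinearMap.smul_apply, LinearMap.smul_apply, h.locality f π hU, smul_zero]
  concentrated := by
    obtain ⟨S, hS, hrect, hμ⟩ := h.concentrated
    exact ⟨S, hS, hrect, by rw [Measure.smul_apply, hμ, smul_zero]⟩
  absolutelyContinuous := Measure.AbsolutelyContinuous.mk fun s _ hs => by
    rw [Measure.smul_apply, h.absolutelyContinuous hs, smul_zero]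

/-- Mass bounds add up, so `Measure.sum μ` bounds the series; this is why an arbitrary bound is
carried along instead of the minimal measure. Summability of `r` provides the domination needed for
weak-* continuity. -/
theorem exists_hasSum {T : ℕ → BddLipFun X →ₗ[ℝ] LipFun X →ₗ[ℝ] ℝ} {μ : ℕ → Measure X}
    (h : ∀ k, IsRectifiableWith (T k) (μ k)) {r : ℕ → ℝ} (hr0 : ∀ k, 0 ≤ r k)
    (hμr : ∀ k, μ k univ ≤ ENNReal.ofReal (r k)) (hr : Summable r) :
    ∃ (T' : BddLipFun X →ₗ[ℝ] LipFun X →ₗ[ℝ] ℝ) (μ' : Measure X), IsRectifiableWith T' μ' ∧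
      (∀ f π, HasSum (fun k => T k f π) (T' f π)) ∧ μ' univ ≤ ENNReal.ofReal (∑' k, r k) := by
  have hfin : ∀ k, IsFiniteMeasure (μ k) := fun k => (h k).isMassBound.1
  have hbound : ∀ (f : BddLipFun X) (C : ℝ), 0 ≤ C → (∀ x, |f.1 x| ≤ C) → ∀ k,
      ∫ x, |f.1 x| ∂(μ k) ≤ C * r k := fun f C hC0 hC k =>
    calc ∫ x, |f.1 x| ∂(μ k) ≤ ∫ _, C ∂(μ k) :=
          integral_mono (integrable_abs_of_mem_bddLipFun f _) (integrable_const C) hC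
      _ = C * (μ k).real univ := by rw [integral_const, smul_eq_mul, mul_comm]
      _ ≤ C * r k := mul_le_mul_of_nonneg_left
          (ENNReal.toReal_le_of_le_ofReal (hr0 k) (hμr k)) hC0
  have hT : ∀ f : BddLipFun X, ∃ C : ℝ, ∀ (π : LipFun X) (K : ℝ≥0), LipschitzWith K π.1 →
      ∀ k, ‖T k f π‖ ≤ K * (C * r k) := by
    intro f
    obtain ⟨-, C, hC⟩ := f.2
    refine ⟨max C 0, fun π K hπ k => ((h k).isMassBound.2 f π K hπ).trans ?_⟩
    exact mul_le_mul_of_nonneg_left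
      (hbound f _ (le_max_right _ _) (fun x => (hC x).trans (le_max_left _ _)) k) K.2
  have hs : ∀ f π, Summable fun k => T k f π := by
    intro f π
    obtain ⟨C, hC⟩ := hT f
    obtain ⟨K, hK⟩ := π.2
    exact Summable.of_norm_bounded ((hr.mul_left C).mul_left (K : ℝ)) (hC π K hK)
  let T' : BddLipFun X →ₗ[ℝ] LipFun X →ₗ[ℝ] ℝ :=
    LinearMap.mk₂ ℝ (fun f π => ∑' k, T k f π)
      (fun f g π => by
        rw [← (hs f π).tsum_add (hs g π)]
        exact tsum_congr fun k => by rw [map_add, LinearMap.add_apply])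
      (fun c f π => by
        rw [smul_eq_mul, ← tsum_mul_left]
        exact tsum_congr fun k => by rw [map_smul, LinearMap.smul_apply, smul_eq_mul])
      (fun f π ρ => by
        rw [← (hs f π).tsum_add (hs f ρ)]
        exact tsum_congr fun k => by rw [map_add])
      (fun c f π => by
        rw [smul_eq_mul, ← tsum_mul_left]
        exact tsum_congr fun k => by rw [map_smul, smul_eq_mul])
  have hT' : ∀ f π, T' f π = ∑' k, T k f π := fun f π => rfl
  have huniv : Measure.sum μ univ ≤ ENNReal.ofReal (∑' k, r k) := by
    rw [Measure.sum_apply _ MeasurableSet.univ, ENNReal.ofReal_tsum_of_nonneg hr0 hr]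
    exact ENNReal.tsum_le_tsum hμr
  have hfin' : IsFiniteMeasure (Measure.sum μ) := ⟨huniv.trans_lt ENNReal.ofReal_lt_top⟩
  refine ⟨T', Measure.sum μ, ⟨⟨hfin', fun f π K hπ => ?_⟩, fun f π ρ K hπ hlim => ?_,
    fun f π hU => ?_, ?_, ?_⟩, fun f π => (hs f π).hasSum, huniv⟩
  · have hsum := (hasSum_integral_measure
      (integrable_abs_of_mem_bddLipFun f (Measure.sum μ))).mul_left (K : ℝ)
    rw [← hsum.tsum_eq]
    exact tsum_of_norm_bounded (f := fun k => T k f π) hsum.summable.hasSum fun k => (h k).isMassBound.2 f π K hπ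
  · obtain ⟨C, hC⟩ := hT f
    exact tendsto_tsum_of_dominated_convergence ((hr.mul_left C).mul_left (K : ℝ))
      (fun k => (h k).continuity f π ρ K hπ hlim)
      (Eventually.of_forall fun j => hC (π j) K (hπ j))
  · rw [hT']
    simp [fun k => (h k).locality f π hU]
  · choose S hS hrect hμ using fun k => (h k).concentrated
    refine ⟨⋃ k, S k, countable_iUnion hS, fun E hE => ?_, ?_⟩
    · obtain ⟨k, hk⟩ := mem_iUnion.1 hE
      exact hrect k E hk
    · refine Measure.sum_apply_eq_zero.2 fun k => measure_mono_null ?_ (hμ k)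
      exact compl_subset_compl.2 (sUnion_mono (subset_iUnion S k))
  · exact Measure.AbsolutelyContinuous.mk fun s _ hs0 =>
      Measure.sum_apply_eq_zero.2 fun k => (h k).absolutelyContinuous hs0

end IsRectifiableWith

theorem isRectifiableWith_curveCurrent {θ : ℝ → X} {K : ℝ≥0} (hθ : LipschitzWith K θ) {z : ℕ → X}
    (hz : DenseRange z) : IsRectifiableWith (curveCurrent θ hθ) (curveMeasure z θ) where
  isMassBound := isMassBound_curveMeasure hθ hz
  continuity := isSeqWeakStarContinuous_curveCurrent hθ
  locality := curveCurrent_locality hθ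
  concentrated := ⟨{θ '' Icc 0 1}, countable_singleton _,
    fun E hE => hE ▸ isOneRectifiableSet_image hθ,
    by rw [sUnion_singleton]; exact curveMeasure_compl_image hθ z⟩
  absolutelyContinuous := curveMeasure_absolutelyContinuous hθ z

/-- The functional `u` is the boundary of a rectifiable current of mass at most `r`. -/
def HasRectifiableFilling (u : AE X) (r : ℝ) : Prop :=
  0 ≤ r ∧ ∃ (T : BddLipFun X →ₗ[ℝ] LipFun X →ₗ[ℝ] ℝ) (μ : Measure X), IsRectifiableWith T μ ∧
    boundary T = toFunctional u ∧ μ univ ≤ ENNReal.ofReal r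

namespace HasRectifiableFilling

theorem zero : HasRectifiableFilling (0 : AE X) 0 :=
  ⟨le_rfl, 0, 0, IsRectifiableWith.zero, (toFunctionalLM (X := X)).map_zero.symm, by simp⟩

theorem add {u v : AE X} {r s : ℝ} (hu : HasRectifiableFilling u r)
    (hv : HasRectifiableFilling v s) : HasRectifiableFilling (u + v) (r + s) := by
  obtain ⟨hr, T, μ, hT, hb, hμ⟩ := hu
  obtain ⟨hs, T', μ', hT', hb', hμ'⟩ := hv
  refine ⟨add_nonneg hr hs, T + T', μ + μ', hT.add hT', ?_, ?_⟩
  · rw [toFunctional_add, ← hb, ← hb']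
    rfl
  · rw [Measure.add_apply, ENNReal.ofReal_add hr hs]
    exact add_le_add hμ hμ'

theorem smul (c : ℝ) {u : AE X} {r : ℝ} (hu : HasRectifiableFilling u r) :
    HasRectifiableFilling (c • u) (|c| * r) := by
  obtain ⟨hr, T, μ, hT, hb, hμ⟩ := hu
  refine ⟨mul_nonneg (abs_nonneg c) hr, c • T, _, hT.smul c, ?_, ?_⟩
  · rw [toFunctional_smul, ← hb]
    rfl
  · rw [Measure.smul_apply, smul_eq_mul, ENNReal.ofReal_mul (abs_nonneg c)]
    gcongr

theorem mono {u : AE X} {r s : ℝ} (hu : HasRectifiableFilling u r) (hrs : r ≤ s) :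
    HasRectifiableFilling u s := by
  obtain ⟨hr, T, μ, hT, hb, hμ⟩ := hu
  exact ⟨hr.trans hrs, T, μ, hT, hb, hμ.trans (ENNReal.ofReal_le_ofReal hrs)⟩

theorem sum {ι : Type*} (s : Finset ι) {u : ι → AE X} {r : ι → ℝ}
    (h : ∀ i, HasRectifiableFilling (u i) (r i)) :
    HasRectifiableFilling (∑ i ∈ s, u i) (∑ i ∈ s, r i) := by
  classical
  induction s using Finset.induction_on with
  | empty => simpa using zero
  | insert a s ha ih => rw [Finset.sum_insert ha, Finset.sum_insert ha]; exact (h a).add ih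

theorem of_curve [TopologicalSpace.SeparableSpace X] {θ : ℝ → X} (hθ : IsLipCurve θ)
    (hlen : curveLength θ ≠ ∞) :
    HasRectifiableFilling (atomMolecule (θ 1) (θ 0) : AE X) (curveLength θ).toReal := by
  have : Nonempty X := ⟨θ 0⟩
  obtain ⟨K, hK⟩ := hθ
  -- Freezing the curve outside `[0, 1]` makes it globally Lipschitz without changing its endpoints
  -- or increasing its length.
  have hK' : LipschitzWith K (Set.IccExtend zero_le_one ((Icc (0 : ℝ) 1).domRestrict θ)) := by
    simpa [IccExtend] using (lipschitzOnWith_iff_restrict.1 hK).comp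
      (LipschitzWith.projIcc zero_le_one)
  have heq : EqOn (Set.IccExtend zero_le_one ((Icc (0 : ℝ) 1).domRestrict θ)) θ (Icc 0 1) :=
    fun t ht => IccExtend_of_mem _ _ ht
  refine ⟨ENNReal.toReal_nonneg, _, _,
    isRectifiableWith_curveCurrent hK' (TopologicalSpace.denseRange_denseSeq X), ?_, ?_⟩
  · ext π
    rw [boundary_curveCurrent, toFunctional_coe, moleculePairing_atomMolecule,
      heq (right_mem_Icc.2 zero_le_one), heq (left_mem_Icc.2 zero_le_one)]
  · rw [ENNReal.ofReal_toReal hlen]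
    exact curveMeasure_univ_le hK' _ heq

end HasRectifiableFilling

/-- The quasiconvexity condition with a fixed constant. -/
def PiecewiseQuasiconvexWith (X : Type*) [MetricSpace X] (c : ℝ) : Prop :=
  ∀ (x y : X) (ε : ℝ), 0 < ε →
    ∃ (n : ℕ) (p q : Fin (n + 1) → X) (θ : Fin (n + 1) → ℝ → X),
      dist x (p 0) + dist (q (Fin.last n)) y
        + ∑ i : Fin n, dist (p i.succ) (q i.castSucc) < ε ∧
      (∀ i, IsLipCurve (θ i) ∧ θ i 0 = p i ∧ θ i 1 = q i) ∧
      ∑ i, curveLength (θ i) ≤ ENNReal.ofReal (c * dist x y)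

theorem Geodesic.piecewiseQuasiconvexWith {X : Type*} [MetricSpace X] (h : Geodesic X) :
    PiecewiseQuasiconvexWith X 1 := by
  intro x y ε hε
  obtain ⟨θ, hθ, h0, h1, hl⟩ := h x y
  exact ⟨0, fun _ => x, fun _ => y, fun _ => θ, by simpa using hε, fun _ => ⟨hθ, h0, h1⟩,
    by simp [hl]⟩

/-- Telescoping: for a broken chain from `y` to `x`, the difference consists exactly of the atoms
that bridge the gaps. -/
theorem norm_atomMolecule_sub_sum_le {X : Type*} [MetricSpace X] (x y : X) {n : ℕ} (p q : Fin (n + 1) → X) :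
    ‖atomMolecule x y - ∑ i, atomMolecule (q i) (p i)‖
      ≤ dist y (p 0) + dist (q (Fin.last n)) x
        + ∑ i : Fin n, dist (p i.succ) (q i.castSucc) := by
  have key : atomMolecule x y - ∑ i, atomMolecule (q i) (p i)
      = atomMolecule (p 0) y + atomMolecule x (q (Fin.last n))
        + ∑ i : Fin n, atomMolecule (p i.succ) (q i.castSucc) := by
    apply Molecule.toFinsupp_injective
    simp only [map_sub, map_add, map_sum, toFinsupp_atomMolecule, atom, Finset.sum_sub_distrib]
    rw [Fin.sum_univ_castSucc (f := fun i => Finsupp.single (q i) (1 : ℝ)),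
      Fin.sum_univ_succ (f := fun i => Finsupp.single (p i) (1 : ℝ))]
    abel
  rw [key]
  refine (norm_add_le _ _).trans (add_le_add ((norm_add_le _ _).trans (add_le_add ?_ ?_))
    ((norm_sum_le _ _).trans (Finset.sum_le_sum fun i _ => norm_atomMolecule_le _ _)))
  · exact (norm_atomMolecule_le _ _).trans (dist_comm _ _).le
  · exact (norm_atomMolecule_le _ _).trans (dist_comm _ _).le

/-- In a piecewise quasiconvex space every element of the Arens-Eells space is the boundary of a
rectifiable current. -/
theorem PiecewiseQuasiconvexWith.hasRectifiableFilling [TopologicalSpace.SeparableSpace X] {c : ℝ}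
    (hc : 0 ≤ c) (h : PiecewiseQuasiconvexWith X c) (u : AE X) {ε : ℝ} (hε : 0 < ε) :
    HasRectifiableFilling u (c * ‖u‖ + ε) := by
  have hatom : ∀ (x y : X) (ε : ℝ), 0 < ε → ∃ v, ‖(atomMolecule x y : AE X) - v‖ < ε ∧
      HasRectifiableFilling v (c * dist x y) := by
    intro x y ε hε
    -- The chain runs from `y` to `x` because the boundary of a curve is its end minus its start.
    obtain ⟨n, p, q, θ, hlt, hθ, hlen⟩ := h y x ε hε
    have hfin : ∀ i, curveLength (θ i) ≠ ∞ := fun i =>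
      ((Finset.single_le_sum (f := fun i => curveLength (θ i)) (fun _ _ => zero_le)
        (Finset.mem_univ i)).trans hlen).trans_lt ENNReal.ofReal_lt_top |>.ne
    refine ⟨∑ i, (atomMolecule (q i) (p i) : AE X), ?_, ?_⟩
    · have e : (∑ i, (atomMolecule (q i) (p i) : AE X))
          = ((∑ i, atomMolecule (q i) (p i) : Molecule X) : AE X) :=
        (map_sum (UniformSpace.Completion.toComplₗᵢ (𝕜 := ℝ) (E := Molecule X)) _ _).symm
      rw [e, ← UniformSpace.Completion.coe_sub, UniformSpace.Completion.norm_coe]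
      exact (norm_atomMolecule_sub_sum_le x y p q).trans_lt hlt
    · refine HasRectifiableFilling.mono (HasRectifiableFilling.sum Finset.univ
        (r := fun i => (curveLength (θ i)).toReal) fun i => ?_) ?_
      · have := HasRectifiableFilling.of_curve (hθ i).1 (hfin i)
        rwa [(hθ i).2.1, (hθ i).2.2] at this
      · rw [← ENNReal.toReal_sum fun i _ => hfin i, dist_comm]
        exact ENNReal.toReal_le_of_le_ofReal (mul_nonneg hc dist_nonneg) hlen
  obtain ⟨v, r, hG, hsum, hr, hle⟩ := AE.exists_hasSum hc (G := HasRectifiableFilling)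
    (fun _ _ h => h.1) HasRectifiableFilling.zero (fun _ _ _ _ => HasRectifiableFilling.add)
    (fun a _ _ => HasRectifiableFilling.smul a) hatom u hε
  choose hr0 T μ hT hb hμ using hG
  obtain ⟨T', μ', hT', hTsum, hμ'⟩ := IsRectifiableWith.exists_hasSum hT hr0 hμ hr
  refine HasRectifiableFilling.mono ⟨tsum_nonneg hr0, T', μ', hT', ?_, hμ'⟩ hle
  ext f
  refine (hTsum (oneBdd X) f).unique ?_
  have := hsum f
  simp only [← hb] at this
  exact this

end rectifiable

/-! ### The mass measure controls the boundary -/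

section mass

variable {X : Type*} [MetricSpace X] [MeasurableSpace X]

/-- `T(1, ·)` is weak-* continuous by the continuity axiom and kills constants, since these have
Lipschitz constant `0` in the mass bound. -/
theorem boundary_mem_range_toFunctional [TopologicalSpace.SeparableSpace X]
    {T : BddLipFun X →ₗ[ℝ] LipFun X →ₗ[ℝ] ℝ} (hT : IsMetricCurrent T) :
    boundary T ∈ range (toFunctional : AE X → LipFun X →ₗ[ℝ] ℝ) := by
  refine mem_range_toFunctional_of_isSeqWeakStarContinuous ?_ (hT.continuity _)
  obtain ⟨μ, hμ⟩ := hT.finite_mass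
  have := hμ.2 (oneBdd X) (oneLip X) 0 (LipschitzWith.const 1)
  rw [NNReal.coe_zero, zero_mul] at this
  exact abs_nonpos_iff.1 this

variable [BorelSpace X]

/-- Inner regularity replaces `s` by a closed subset, whose indicator is a limit of Lipschitz
thickened indicators. -/
theorem exists_bddLipFun_integral_sub_indicator_le (μ : Measure X) [IsFiniteMeasure μ] {s : Set X}
    (hs : MeasurableSet s) {ε : ℝ} (hε : 0 < ε) :
    ∃ f : BddLipFun X, ∫ x, |f.1 x - s.indicator 1 x| ∂μ ≤ ε := by
  obtain ⟨F, hFs, hF, hFμ⟩ := hs.exists_isClosed_sdiff_lt (measure_ne_top μ s)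
    (ENNReal.ofReal_pos.2 (half_pos hε)).ne'
  have hlim := tendsto_integral_thickenedIndicator_of_isClosed μ hF
    (δs := fun n : ℕ => (1 : ℝ) / (n + 1)) (fun _ => by positivity)
    tendsto_one_div_add_atTop_nhds_zero_nat
  obtain ⟨n, hn⟩ := (hlim.eventually_lt_const
    (lt_add_of_pos_right (μ.real F) (half_pos hε))).exists
  have hpos : (0 : ℝ) < 1 / (n + 1) := by positivity
  have hmem : (fun x => (thickenedIndicator hpos F x : ℝ)) ∈ BddLipFun X := by
    refine ⟨⟨_, lipschitzWith_thickenedIndicator hpos F⟩, 1, fun x => ?_⟩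
    rw [abs_of_nonneg (NNReal.coe_nonneg _)]
    exact_mod_cast thickenedIndicator_le_one hpos F x
  refine ⟨⟨_, hmem⟩, ?_⟩
  have hi : Integrable (fun x => (thickenedIndicator hpos F x : ℝ)) μ :=
    integrable_thickenedIndicator _ _
  have hiF : Integrable (F.indicator (1 : X → ℝ)) μ :=
    (integrable_const (1 : ℝ)).indicator hF.measurableSet
  have his : Integrable (s.indicator (1 : X → ℝ)) μ := (integrable_const (1 : ℝ)).indicator hs
  have h1 : ∀ x, |(thickenedIndicator hpos F x : ℝ) - s.indicator 1 x|
      ≤ ((thickenedIndicator hpos F x : ℝ) - F.indicator 1 x)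
        + (s.indicator 1 x - F.indicator 1 x) := by
    intro x
    have a1 : F.indicator (1 : X → ℝ) x ≤ thickenedIndicator hpos F x := by
      by_cases hx : x ∈ F
      · rw [thickenedIndicator_one hpos F hx]; simp [hx]
      · simp [hx]
    have a2 : F.indicator (1 : X → ℝ) x ≤ s.indicator 1 x :=
      indicator_le_indicator_of_subset hFs (fun _ => zero_le_one) x
    rw [abs_le]
    constructor <;> linarith
  calc ∫ x, |(thickenedIndicator hpos F x : ℝ) - s.indicator 1 x| ∂μ
      ≤ ∫ x, ((thickenedIndicator hpos F x : ℝ) - F.indicator 1 x)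
        + (s.indicator 1 x - F.indicator 1 x) ∂μ :=
        integral_mono (hi.sub his).abs ((hi.sub hiF).add (his.sub hiF)) h1
    _ = (∫ x, (thickenedIndicator hpos F x : ℝ) ∂μ - μ.real F) + (μ.real s - μ.real F) := by
        have i1 := integral_sub hi hiF
        have i2 := integral_sub his hiF
        rw [integral_indicator_one hF.measurableSet] at i1 i2
        rw [integral_indicator_one hs] at i2
        exact (integral_add (hi.sub hiF) (his.sub hiF)).trans (congrArg₂ _ i1 i2)
    _ ≤ ε / 2 + ε / 2 := by
        refine add_le_add (by linarith) ?_
        rw [← measureReal_sdiff hFs hF.measurableSet]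
        exact ENNReal.toReal_le_of_le_ofReal (half_pos hε).le hFμ.le
    _ = ε := add_halves ε

/-- The function `1` is split into approximate indicators of the disjoint sets and a remainder. Each
piece is estimated with its own measure, the remainder with `μ₀`. -/
theorem abs_le_sum_measureReal {a : BddLipFun X →ₗ[ℝ] ℝ} {μ₀ : Measure X} [IsFiniteMeasure μ₀]
    (h₀ : ∀ f, |a f| ≤ ∫ x, |f.1 x| ∂μ₀) {N : ℕ} (μ : Fin N → Measure X)
    [∀ k, IsFiniteMeasure (μ k)] (h : ∀ k f, |a f| ≤ ∫ x, |f.1 x| ∂(μ k)) (t : Fin N → Set X)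
    (ht : ∀ k, MeasurableSet (t k)) (hd : Pairwise (Function.onFun Disjoint t)) :
    |a (oneBdd X)| ≤ ∑ k, (μ k).real (t k) + μ₀.real (⋃ k, t k)ᶜ := by
  refine le_of_forall_pos_le_add fun ε hε => ?_
  set δ : ℝ := ε / (2 * (N + 1)) with hδ
  have hδp : 0 < δ := by positivity
  -- Approximating for `μ₀ + μ k` controls the error in both measures: `μ k` is used for the piece
  -- itself, `μ₀` for the remainder.
  choose f hf using fun k =>
    exists_bddLipFun_integral_sub_indicator_le (μ₀ + μ k) (ht k) hδp
  have hif : ∀ (k : Fin N) (g : BddLipFun X) (ν : Measure X) [IsFiniteMeasure ν],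
      Integrable (fun x => |g.1 x - (t k).indicator 1 x|) ν := by
    intro k g ν _
    have h1 : Integrable g.1 ν := by
      have := integrable_abs_of_mem_bddLipFun g ν
      exact (integrable_norm_iff
        (continuous_of_mem_bddLipFun g).measurable.aestronglyMeasurable).1 this
    exact (h1.sub ((integrable_const (1 : ℝ)).indicator (ht k))).abs
  have hf0 : ∀ k, ∫ x, |(f k).1 x - (t k).indicator 1 x| ∂μ₀ ≤ δ := fun k => by
    have := hf k
    rw [integral_add_measure (hif k _ _) (hif k _ _)] at this
    have h2 : 0 ≤ ∫ x, |(f k).1 x - (t k).indicator 1 x| ∂(μ k) :=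
      integral_nonneg fun _ => abs_nonneg _
    linarith
  have hfk : ∀ k, ∫ x, |(f k).1 x - (t k).indicator 1 x| ∂(μ k) ≤ δ := fun k => by
    have := hf k
    rw [integral_add_measure (hif k _ _) (hif k _ _)] at this
    have h2 : 0 ≤ ∫ x, |(f k).1 x - (t k).indicator 1 x| ∂μ₀ :=
      integral_nonneg fun _ => abs_nonneg _
    linarith
  have hmain : ∀ k, |a (f k)| ≤ (μ k).real (t k) + δ := by
    intro k
    refine (h k (f k)).trans ?_
    have his : Integrable ((t k).indicator (1 : X → ℝ)) (μ k) :=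
      (integrable_const (1 : ℝ)).indicator (ht k)
    calc ∫ x, |(f k).1 x| ∂(μ k)
        ≤ ∫ x, (t k).indicator 1 x + |(f k).1 x - (t k).indicator 1 x| ∂(μ k) := by
          refine integral_mono (integrable_abs_of_mem_bddLipFun _ _) (his.add (hif k _ _))
            fun x => ?_
          have h1 := abs_add_le ((t k).indicator (1 : X → ℝ) x)
            ((f k).1 x - (t k).indicator 1 x)
          rwa [add_sub_cancel, abs_of_nonneg (a := (t k).indicator (1 : X → ℝ) x)
            (indicator_nonneg (fun _ _ => zero_le_one) x)] at h1
      _ = (μ k).real (t k) + ∫ x, |(f k).1 x - (t k).indicator 1 x| ∂(μ k) := by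
          rw [integral_add his (hif k _ _), integral_indicator_one (ht k)]
      _ ≤ _ := by linarith [hfk k]
  have hrest : |a (oneBdd X - ∑ k, f k)| ≤ μ₀.real (⋃ k, t k)ᶜ + N * δ := by
    refine (h₀ _).trans ?_
    have hm : MeasurableSet (⋃ k, t k)ᶜ := (MeasurableSet.iUnion ht).compl
    have his : Integrable ((⋃ k, t k)ᶜ.indicator (1 : X → ℝ)) μ₀ :=
      (integrable_const (1 : ℝ)).indicator hm
    have hpt : ∀ x, |(oneBdd X - ∑ k, f k).1 x| ≤ (⋃ k, t k)ᶜ.indicator 1 x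
        + ∑ k, |(f k).1 x - (t k).indicator 1 x| := by
      intro x
      have e1 : (1 : ℝ) = (⋃ k, t k)ᶜ.indicator 1 x + ∑ k, (t k).indicator (1 : X → ℝ) x := by
        by_cases hx : x ∈ ⋃ k, t k
        · obtain ⟨k, hk⟩ := mem_iUnion.1 hx
          rw [indicator_of_notMem (by simpa using hx), zero_add, Finset.sum_eq_single k]
          · simp [hk]
          · intro j _ hjk
            exact indicator_of_notMem (fun hj => (hd hjk).le_bot ⟨hj, hk⟩) _
          · simp
        · rw [indicator_of_mem (by simpa using hx), Finset.sum_eq_zero]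
          · simp
          · intro j _
            exact indicator_of_notMem (fun hj => hx (mem_iUnion.2 ⟨j, hj⟩)) _
      have e2 : (oneBdd X - ∑ k, f k).1 x = (⋃ k, t k)ᶜ.indicator 1 x
          - ∑ k, ((f k).1 x - (t k).indicator 1 x) := by
        rw [Finset.sum_sub_distrib]
        have : (oneBdd X - ∑ k, f k).1 x = 1 - ∑ k, (f k).1 x := by
          simp [oneBdd, Finset.sum_apply]
        rw [this]
        linarith
      rw [e2]
      refine (abs_sub _ _).trans (add_le_add ?_ (Finset.abs_sum_le_sum_abs _ _))
      exact (abs_of_nonneg (indicator_nonneg (f := (1 : X → ℝ)) (fun _ _ => zero_le_one) x)).le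
    have hsumi : Integrable (fun x => ∑ k, |(f k).1 x - (t k).indicator 1 x|) μ₀ :=
      integrable_finsetSum _ fun k _ => hif k _ _
    calc ∫ x, |(oneBdd X - ∑ k, f k).1 x| ∂μ₀
        ≤ ∫ x, (⋃ k, t k)ᶜ.indicator 1 x + ∑ k, |(f k).1 x - (t k).indicator 1 x| ∂μ₀ :=
          integral_mono (integrable_abs_of_mem_bddLipFun _ _) (his.add hsumi) hpt
      _ = μ₀.real (⋃ k, t k)ᶜ + ∑ k, ∫ x, |(f k).1 x - (t k).indicator 1 x| ∂μ₀ := by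
          rw [integral_add his hsumi, integral_indicator_one hm,
            integral_finsetSum _ fun k _ => hif k _ _]
      _ ≤ μ₀.real (⋃ k, t k)ᶜ + ∑ _k : Fin N, δ := by
          gcongr with k
          exact hf0 k
      _ = _ := by simp
  have hsplit : a (oneBdd X) = ∑ k, a (f k) + a (oneBdd X - ∑ k, f k) := by
    rw [map_sub, map_sum]
    ring
  calc |a (oneBdd X)| ≤ ∑ k, |a (f k)| + |a (oneBdd X - ∑ k, f k)| := by
        rw [hsplit]
        exact (abs_add_le _ _).trans (add_le_add (Finset.abs_sum_le_sum_abs _ _) le_rfl)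
    _ ≤ ∑ k, ((μ k).real (t k) + δ) + (μ₀.real (⋃ k, t k)ᶜ + N * δ) :=
        add_le_add (Finset.sum_le_sum fun k _ => hmain k) hrest
    _ = ∑ k, (μ k).real (t k) + μ₀.real (⋃ k, t k)ᶜ + 2 * N * δ := by
        rw [Finset.sum_add_distrib]
        simp
        ring
    _ ≤ _ := by
        have : 2 * N * δ ≤ ε := by
          rw [hδ, mul_div_assoc', div_le_iff₀ (by positivity)]
          nlinarith
        linarith

/-- The infimum measure of the whole space is computed from countable covers, each member charged by
the cheapest measure. Choosing a nearly optimal measure for each member and making the cover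
disjoint reduces the claim to `abs_le_sum_measureReal`. This does not require that the infimum is
itself a bound. -/
theorem ofReal_abs_le_sInf_univ {a : BddLipFun X →ₗ[ℝ] ℝ} {M : Set (Measure X)}
    (hne : M.Nonempty) (hM : ∀ μ ∈ M, IsFiniteMeasure μ ∧ ∀ f, |a f| ≤ ∫ x, |f.1 x| ∂μ) :
    ENNReal.ofReal |a (oneBdd X)| ≤ sInf M univ := by
  obtain ⟨μ₀, hμ₀⟩ := hne
  have := (hM μ₀ hμ₀).1
  rw [Measure.sInf_apply MeasurableSet.univ, OuterMeasure.sInf_apply ⟨_, mem_image_of_mem _ hμ₀⟩]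
  refine le_iInf₂ fun t ht => ENNReal.le_of_forall_pos_le_add fun ε hε _ => ?_
  have hε2 : (ε : ℝ≥0∞) / 2 ≠ 0 := by simpa using hε.ne'
  obtain ⟨δ, hδ, hδε⟩ := ENNReal.exists_pos_sum_of_countable hε2 ℕ
  have hch : ∀ n, ∃ μ ∈ M, μ (t n) ≤ (⨅ μ ∈ Measure.toOuterMeasure '' M, μ (t n)) + δ n := by
    intro n
    by_cases htop : (⨅ μ ∈ Measure.toOuterMeasure '' M, μ (t n)) = ∞
    · exact ⟨μ₀, hμ₀, by rw [htop, top_add]; exact le_top⟩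
    have hlt := ENNReal.lt_add_right htop (ENNReal.coe_pos.2 (hδ n)).ne'
    obtain ⟨_, hlt⟩ := iInf_lt_iff.1 hlt
    obtain ⟨⟨μ, hμ, rfl⟩, hlt⟩ := iInf_lt_iff.1 hlt
    exact ⟨μ, hμ, hlt.le⟩
  choose μ hμM hμt using hch
  have hfin : ∀ n, IsFiniteMeasure (μ n) := fun n => (hM _ (hμM n)).1
  -- The cover need not be measurable; each member is replaced by its measurable hull for its own
  -- measure before overlaps are removed.
  set s : ℕ → Set X := disjointed fun n => toMeasurable (μ n) (t n) with hs
  have hsm : ∀ n, MeasurableSet (s n) :=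
    fun n => MeasurableSet.disjointed (fun n => measurableSet_toMeasurable _ _) n
  have hsμ : ∀ n, μ n (s n) ≤ μ n (t n) := fun n =>
    (measure_mono (disjointed_subset _ n)).trans (measure_toMeasurable _).le
  have hcov : ⋃ n, s n = univ := by
    rw [hs, iUnion_disjointed]
    exact univ_subset_iff.1 (ht.trans (iUnion_mono fun n => subset_toMeasurable _ _))
  -- Only finitely many pieces can be treated at once; the finite measure `μ₀` absorbs what is left.
  have hrest : Tendsto (fun N : ℕ => μ₀ (⋃ k : Fin N, s k)ᶜ) atTop (𝓝 0) := by
    have h1 : Antitone fun N : ℕ => (⋃ k : Fin N, s k)ᶜ := by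
      intro N N' hN
      refine compl_subset_compl.2 (iUnion_subset fun k => ?_)
      exact subset_iUnion_of_subset (Fin.castLE hN k) (by rfl)
    have h2 := tendsto_measure_iInter_atTop (μ := μ₀)
      (fun N => (MeasurableSet.iUnion fun k : Fin N => hsm k).compl.nullMeasurableSet) h1
      ⟨0, measure_ne_top _ _⟩
    have h3 : ⋂ N : ℕ, (⋃ k : Fin N, s k)ᶜ = ∅ := by
      rw [← compl_iUnion, compl_empty_iff, ← univ_subset_iff, ← hcov]
      exact iUnion_subset fun n => subset_iUnion_of_subset (n + 1)
        (subset_iUnion_of_subset (Fin.last n) (by rfl))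
    rwa [h3, measure_empty] at h2
  obtain ⟨N, hN⟩ := (hrest.eventually_lt_const (pos_iff_ne_zero.2 hε2)).exists
  have hfinal := abs_le_sum_measureReal (hM _ hμ₀).2 (fun k : Fin N => μ k)
    (fun k => (hM _ (hμM k)).2) (fun k => s k) (fun k => hsm k)
    (fun i j hij => disjoint_disjointed _ (Fin.val_injective.ne hij))
  calc ENNReal.ofReal |a (oneBdd X)|
      ≤ ∑ k : Fin N, μ k (s k) + μ₀ (⋃ k : Fin N, s k)ᶜ := by
        refine (ENNReal.ofReal_le_ofReal hfinal).trans (ENNReal.ofReal_add_le.trans ?_)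
        rw [ENNReal.ofReal_sum_of_nonneg fun _ _ => measureReal_nonneg]
        exact add_le_add (Finset.sum_le_sum fun k _ => (ofReal_measureReal (measure_ne_top _ _)).le)
          (ofReal_measureReal (measure_ne_top _ _)).le
    _ ≤ ∑ k : Fin N, ((⨅ μ ∈ Measure.toOuterMeasure '' M, μ (t k)) + δ k) + ε / 2 := by
        gcongr with k
        exact (hsμ k).trans (hμt k)
    _ ≤ ∑' k, ((⨅ μ ∈ Measure.toOuterMeasure '' M, μ (t k)) + δ k) + ε / 2 := by
        gcongr
        rw [Fin.sum_univ_eq_sum_range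
          (fun k => (⨅ μ ∈ Measure.toOuterMeasure '' M, μ (t k)) + (δ k : ℝ≥0∞))]
        exact ENNReal.sum_le_tsum _
    _ ≤ ∑' k, (⨅ μ ∈ Measure.toOuterMeasure '' M, μ (t k)) + ε := by
        rw [ENNReal.tsum_add, add_assoc]
        gcongr
        calc _ ≤ (ε : ℝ≥0∞) / 2 + ε / 2 := by gcongr
          _ = ε := ENNReal.add_halves _

theorem ofReal_abs_boundary_le_mass {T : BddLipFun X →ₗ[ℝ] LipFun X →ₗ[ℝ] ℝ}
    (hT : IsMetricCurrent T) {π : LipFun X} (hπ : LipschitzWith 1 π.1) :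
    ENNReal.ofReal |boundary T π| ≤ mass T :=
  ofReal_abs_le_sInf_univ (a := T.flip π) hT.finite_mass fun μ hμ =>
    ⟨hμ.1, fun f => by simpa using hμ.2 f π 1 hπ⟩

end mass

/-! ### Metric spaces -/

section metricSpace

variable {X : Type*} [MetricSpace X] [TopologicalSpace.SeparableSpace X] [MeasurableSpace X]
  [BorelSpace X]

theorem range_toFunctional_eq_boundaries (h : PiecewiseQuasiconvex X) :
    range (toFunctional : AE X → LipFun X →ₗ[ℝ] ℝ)
        = {φ | ∃ T, IsMetricCurrent T ∧ boundary T = φ} ∧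
      range (toFunctional : AE X → LipFun X →ₗ[ℝ] ℝ)
        = {φ | ∃ T, IsMetricCurrent T ∧ IsRectifiable T ∧ boundary T = φ} := by
  obtain ⟨c, hc, h⟩ := h
  have h1 : range (toFunctional : AE X → LipFun X →ₗ[ℝ] ℝ)
      ⊆ {φ | ∃ T, IsMetricCurrent T ∧ IsRectifiable T ∧ boundary T = φ} := by
    rintro _ ⟨u, rfl⟩
    obtain ⟨-, T, μ, hT, hb, -⟩ := PiecewiseQuasiconvexWith.hasRectifiableFilling
      (zero_le_one.trans hc) h u one_pos
    exact ⟨T, hT.isMetricCurrent, hT.isRectifiable, hb⟩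
  have h2 : {φ | ∃ T : BddLipFun X →ₗ[ℝ] LipFun X →ₗ[ℝ] ℝ,
        IsMetricCurrent T ∧ IsRectifiable T ∧ boundary T = φ}
      ⊆ {φ | ∃ T, IsMetricCurrent T ∧ boundary T = φ} :=
    fun φ ⟨T, hT, _, hb⟩ => ⟨T, hT, hb⟩
  have h3 : {φ | ∃ T, IsMetricCurrent T ∧ boundary T = φ}
      ⊆ range (toFunctional : AE X → LipFun X →ₗ[ℝ] ℝ) := by
    rintro _ ⟨T, hT, rfl⟩
    exact boundary_mem_range_toFunctional hT
  exact ⟨(h1.trans h2).antisymm h3, h1.antisymm (h2.trans h3)⟩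

theorem krNorm_eq_iInf_mass (h : Geodesic X) (u : AE X) :
    krNorm (toFunctional u)
      = ⨅ (T) (_ : IsMetricCurrent T ∧ boundary T = toFunctional u), mass T := by
  refine le_antisymm (le_iInf₂ fun T hT => iSup₂_le fun f hf => ?_) ?_
  · rw [← hT.2]
    exact (ENNReal.ofReal_le_ofReal (le_abs_self _)).trans (ofReal_abs_boundary_le_mass hT.1 hf)
  · rw [krNorm_toFunctional]
    refine ENNReal.le_of_forall_pos_le_add fun ε hε _ => ?_
    obtain ⟨-, T, μ, hT, hb, hμ⟩ := h.piecewiseQuasiconvexWith.hasRectifiableFilling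
      zero_le_one u (NNReal.coe_pos.2 hε)
    refine (iInf₂_le T ⟨hT.isMetricCurrent, hb⟩).trans
      ((hT.massMeasure_le univ).trans (hμ.trans ?_))
    rw [one_mul, ENNReal.ofReal_add (norm_nonneg u) (NNReal.coe_nonneg ε), ENNReal.ofReal_coe_nnreal]

end metricSpace

/-! ### Smooth compactly supported functions are weak-* dense -/

section density

variable {d : ℕ}

/-- The `0`-form given by a smooth compactly supported function. -/
def scalarForm (g : Euc d → ℝ) (hg : ContDiff ℝ (⊤ : ℕ∞) g) (hc : HasCompactSupport g) :
    TestForm d 0 :=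
  ⟨fun x => ContinuousAlternatingMap.constOfIsEmptyLIE ℝ (Euc d) ℝ (Fin 0) (g x),
    (ContinuousAlternatingMap.constOfIsEmptyLIE ℝ (Euc d) ℝ (Fin 0)).contDiff.comp hg,
    hc.comp_left (map_zero _)⟩

theorem testToLip_scalarForm (g : Euc d → ℝ) (hg : ContDiff ℝ (⊤ : ℕ∞) g)
    (hc : HasCompactSupport g) : (testToLip d (scalarForm g hg hc)).1 = g := rfl

theorem testToLip_apply (ω : TestForm d 0) (x : Euc d) (v : Fin 0 → Euc d) :
    (testToLip d ω).1 x = ω.1 x v := by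
  rw [Subsingleton.elim v 0]
  rfl

theorem contDiff_testToLip (ω : TestForm d 0) : ContDiff ℝ (⊤ : ℕ∞) (testToLip d ω).1 :=
  (ContinuousAlternatingMap.apply ℝ (Euc d) ℝ (0 : Fin 0 → Euc d)).contDiff.comp ω.2.1

theorem norm_testForm_zero (ω : TestForm d 0) (x : Euc d) : ‖ω.1 x‖ = |(testToLip d ω).1 x| := by
  have h : ω.1 x = ContinuousAlternatingMap.constOfIsEmptyLIE ℝ (Euc d) ℝ (Fin 0)
      ((testToLip d ω).1 x) := by
    ext v
    rw [testToLip_apply ω x v]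
    rfl
  rw [h, LinearIsometryEquiv.norm_map, Real.norm_eq_abs]

/-- Mollification preserves the Lipschitz constant. -/
theorem exists_mollification {f : Euc d → ℝ} {K : ℝ≥0} (hf : LipschitzWith K f)
    (hc : HasCompactSupport f) {r : ℝ} (hr : 0 < r) :
    ∃ g : Euc d → ℝ, ContDiff ℝ (⊤ : ℕ∞) g ∧ HasCompactSupport g ∧ LipschitzWith K g ∧
      ∀ x, dist (g x) (f x) ≤ K * r := by
  let φ : ContDiffBump (0 : Euc d) := ⟨r / 2, r, half_pos hr, half_lt_self hr⟩
  refine ⟨convolution (φ.normed volume) f (ContinuousLinearMap.lsmul ℝ ℝ) volume, ?_, ?_, ?_, ?_⟩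
  · exact φ.hasCompactSupport_normed.contDiff_convolution_left _ φ.contDiff_normed
      hf.continuous.locallyIntegrable
  · exact φ.hasCompactSupport_normed.convolution (ContinuousLinearMap.lsmul ℝ ℝ) hc
  · have hint : ∀ x, Integrable (fun t => φ.normed volume t * f (x - t)) := fun x =>
      (φ.continuous_normed.mul (hf.continuous.comp (continuous_const.sub continuous_id)))
        |>.integrable_of_hasCompactSupport φ.hasCompactSupport_normed.mul_right
    refine LipschitzWith.of_dist_le_mul fun x y => ?_
    rw [convolution_def, convolution_def, dist_eq_norm]
    simp only [ContinuousLinearMap.lsmul_apply, smul_eq_mul]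
    rw [← integral_sub (hint x) (hint y)]
    have hφ : Integrable (fun t => φ.normed volume t * (K * dist x y)) :=
      (φ.integrable_normed (μ := volume)).mul_const _
    refine (norm_integral_le_of_norm_le hφ (Eventually.of_forall fun t => ?_)).trans ?_
    · rw [← mul_sub, norm_mul, Real.norm_of_nonneg (φ.nonneg_normed t)]
      refine mul_le_mul_of_nonneg_left ?_ (φ.nonneg_normed t)
      have := hf.dist_le_mul (x - t) (y - t)
      rwa [dist_sub_right, Real.dist_eq] at this
    · rw [integral_mul_const, φ.integral_normed, one_mul]
  · intro x
    refine φ.dist_normed_convolution_le hf.continuous.aestronglyMeasurable fun y hy => ?_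
    exact (hf.dist_le_mul y x).trans (mul_le_mul_of_nonneg_left (Metric.mem_ball.1 hy).le K.2)

/-- The truncation of a function between the graphs of a cone and of its opposite. -/
def coneTruncation (f : Euc d → ℝ) (K : ℝ≥0) (R : ℝ) (x : Euc d) : ℝ :=
  max (min (f x) (max (R - K * ‖x‖) 0)) (-max (R - K * ‖x‖) 0)

theorem lipschitzWith_coneTruncation {f : Euc d → ℝ} {K : ℝ≥0} (hf : LipschitzWith K f) (R : ℝ) :
    LipschitzWith K (coneTruncation f K R) := by
  have h1 : LipschitzWith K fun x : Euc d => max (R - K * ‖x‖) 0 := by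
    refine LipschitzWith.max_const (LipschitzWith.of_dist_le_mul fun x y => ?_) 0
    rw [Real.dist_eq, sub_sub_sub_cancel_left, ← mul_sub, abs_mul, abs_of_nonneg (NNReal.coe_nonneg K), dist_comm,
      dist_eq_norm]
    exact mul_le_mul_of_nonneg_left (abs_norm_sub_norm_le _ _) K.2
  have := (hf.min h1).max h1.neg
  rw [max_self, max_self] at this
  exact this

theorem coneTruncation_of_le {f : Euc d → ℝ} {K : ℝ≥0} {R : ℝ} {x : Euc d}
    (h : |f x| + K * ‖x‖ ≤ R) : coneTruncation f K R x = f x := by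
  have h1 := abs_le.1 (show |f x| ≤ max (R - K * ‖x‖) 0 from
    le_max_of_le_left (by linarith))
  rw [coneTruncation, min_eq_left h1.2, max_eq_left h1.1]

theorem hasCompactSupport_coneTruncation (f : Euc d → ℝ) {K : ℝ≥0} (hK : 0 < K) (R : ℝ) :
    HasCompactSupport (coneTruncation f K R) := by
  refine HasCompactSupport.intro (isCompact_closedBall (0 : Euc d) (R / K)) fun x hx => ?_
  rw [Metric.mem_closedBall, dist_zero_right, not_le, div_lt_iff₀ (NNReal.coe_pos.2 hK)] at hx
  have h0 : max (R - K * ‖x‖) 0 = 0 := max_eq_right (by linarith)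
  rw [coneTruncation, h0, neg_zero]
  exact max_eq_right (min_le_right _ _)

/-- Truncation between cones of slope `K` gives compact support, and mollification gives smoothness;
neither raises the Lipschitz constant, whereas multiplication by a cutoff could. The cone reaches
zero only if `K > 0`, which explains the positivity in `IsLipDense`. -/
theorem isLipDense_testToLip (d : ℕ) : IsLipDense (V := TestForm d 0) (testToLip d) := by
  intro f K hK hf
  have H : ∀ j : ℕ, ∃ v : TestForm d 0, LipschitzWith K (testToLip d v).1 ∧
      ∀ x, dist ((testToLip d v).1 x) (coneTruncation f.1 K j x) ≤ K * (1 / (j + 1)) := by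
    intro j
    obtain ⟨g, hg, hgc, hgK, hgd⟩ := exists_mollification (lipschitzWith_coneTruncation hf j)
      (hasCompactSupport_coneTruncation f.1 hK j) (r := 1 / (j + 1)) (by positivity)
    exact ⟨scalarForm g hg hgc, hgK, hgd⟩
  choose v hv hvd using H
  refine ⟨v, hv, fun x => ?_⟩
  obtain ⟨N, hN⟩ := exists_nat_ge (|f.1 x| + K * ‖x‖)
  rw [tendsto_iff_dist_tendsto_zero]
  have hlim := (tendsto_one_div_add_atTop_nhds_zero_nat (𝕜 := ℝ)).const_mul (K : ℝ)
  rw [mul_zero] at hlim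
  refine squeeze_zero' (Eventually.of_forall fun _ => dist_nonneg) ?_ hlim
  filter_upwards [eventually_ge_atTop N] with j hj
  have h1 := hvd j x
  rwa [coneTruncation_of_le (hN.trans (by exact_mod_cast hj))] at h1

theorem injOn_toDistribution (d : ℕ) : InjOn toDistribution (M01 d) := by
  intro φ hφ φ' hφ' h
  ext f
  obtain ⟨K, hK⟩ := f.2
  -- Density is available only for positive constants, so `K` is enlarged.
  have hK1 : LipschitzWith (K + 1) f.1 := hK.weaken le_self_add
  obtain ⟨v, hv, hvf⟩ := isLipDense_testToLip d f (K + 1) (by positivity) hK1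
  refine tendsto_nhds_unique (hφ.2 _ f _ hv hvf) ?_
  have e : ∀ j, φ (testToLip d (v j)) = φ' (testToLip d (v j)) :=
    fun j => LinearMap.congr_fun h (v j)
  simp only [e]
  exact hφ'.2 _ f _ hv hvf

theorem range_toFunctional_eq_M01 (d : ℕ) :
    range (toFunctional : AE (Euc d) → LipFun (Euc d) →ₗ[ℝ] ℝ) = M01 d := by
  refine Subset.antisymm ?_ fun φ hφ => mem_range_toFunctional_of_isSeqWeakStarContinuous hφ.1 hφ.2
  rintro _ ⟨u, rfl⟩
  exact ⟨toFunctional_oneLip u, isSeqWeakStarContinuous_toFunctional u⟩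

end density

/-! ### Masses of currents in Euclidean space -/

section ffMass

variable {d k : ℕ}

theorem ffMass_le {T : FFCurrent d k} {C : ℝ} (h : ∀ ω : TestForm d k, (∀ x, ‖ω.1 x‖ ≤ 1) → T ω ≤ C) :
    ffMass T ≤ ENNReal.ofReal C :=
  iSup₂_le fun ω hω => ENNReal.ofReal_le_ofReal (h ω hω)

theorem abs_le_ffMass {T : FFCurrent d k} (hT : ffMass T ≠ ∞) {ω : TestForm d k} {B : ℝ}
    (hω : ∀ x, ‖ω.1 x‖ ≤ B) : |T ω| ≤ (ffMass T).toReal * B := by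
  have h1 : ∀ η : TestForm d k, (∀ x, ‖η.1 x‖ ≤ 1) → T η ≤ (ffMass T).toReal := fun η hη =>
    (ENNReal.ofReal_le_iff_le_toReal hT).1
      (le_iSup₂ (f := fun (ω : TestForm d k) (_ : ∀ x, ‖ω.1 x‖ ≤ 1) => ENNReal.ofReal (T ω)) η hη)
  rcases lt_or_ge 0 B with hB | hB
  · have h2 : ∀ η : TestForm d k, (∀ x, ‖η.1 x‖ ≤ B) → T η ≤ (ffMass T).toReal * B := by
      intro η hη
      have := h1 (B⁻¹ • η) fun x => by
        rw [Submodule.coe_smul, Pi.smul_apply, norm_smul, Real.norm_of_nonneg (inv_nonneg.2 hB.le)]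
        exact (inv_mul_le_iff₀ hB).2 (by simpa using hη x)
      rw [map_smul, smul_eq_mul, inv_mul_le_iff₀ hB] at this
      linarith
    refine abs_le.2 ⟨?_, h2 ω hω⟩
    have := h2 (-ω) fun x => by simpa using hω x
    rw [map_neg T ω] at this
    linarith
  · have h0 : ω = 0 := by
      ext1
      funext x
      exact norm_le_zero_iff.1 ((hω x).trans hB)
    have hB0 : B = 0 := by
      refine le_antisymm hB ((norm_nonneg _).trans (hω 0))
    rw [h0, hB0, map_zero, abs_zero, mul_zero]

theorem ffMass_zero : ffMass (0 : FFCurrent d k) = 0 := by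
  simp [ffMass]

theorem ffMass_add_le (S T : FFCurrent d k) : ffMass (S + T) ≤ ffMass S + ffMass T := by
  refine iSup₂_le fun ω hω => ENNReal.ofReal_add_le.trans (add_le_add ?_ ?_)
  · exact le_iSup₂ (f := fun (ω : TestForm d k) (_ : ∀ x, ‖ω.1 x‖ ≤ 1) => ENNReal.ofReal (S ω)) ω hω
  · exact le_iSup₂ (f := fun (ω : TestForm d k) (_ : ∀ x, ‖ω.1 x‖ ≤ 1) => ENNReal.ofReal (T ω)) ω hω

theorem ffMass_smul_le (c : ℝ) (T : FFCurrent d k) :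
    ffMass (c • T) ≤ ENNReal.ofReal |c| * ffMass T := by
  refine iSup₂_le fun ω hω => ?_
  rcases le_total 0 c with hc | hc
  · rw [abs_of_nonneg hc, LinearMap.smul_apply, smul_eq_mul, ENNReal.ofReal_mul hc]
    gcongr
    exact le_iSup₂ (f := fun (ω : TestForm d k) (_ : ∀ x, ‖ω.1 x‖ ≤ 1) => ENNReal.ofReal (T ω)) ω hω
  · rw [abs_of_nonpos hc, LinearMap.smul_apply, smul_eq_mul, ← neg_mul_neg, ← map_neg T ω,
      ENNReal.ofReal_mul (neg_nonneg.2 hc)]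
    gcongr
    exact le_iSup₂ (f := fun (ω : TestForm d k) (_ : ∀ x, ‖ω.1 x‖ ≤ 1) => ENNReal.ofReal (T ω)) (-ω)
      fun x => by simpa using hω x

theorem ffBoundary_add (S T : FFCurrent d (k + 1)) :
    ffBoundary (S + T) = ffBoundary S + ffBoundary T := rfl

theorem ffBoundary_smul (c : ℝ) (T : FFCurrent d (k + 1)) :
    ffBoundary (c • T) = c • ffBoundary T := rfl

theorem ffBoundary_apply (T : FFCurrent d (k + 1)) (ω : TestForm d k) :
    ffBoundary T ω = T (extD d k ω) := rfl

theorem ffBoundary_ffBoundary (S : FFCurrent d (k + 2)) : ffBoundary (ffBoundary S) = 0 := by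
  ext ω
  have h : extD d (k + 1) (extD d k ω) = 0 := by
    ext1
    exact extDeriv_extDeriv (ω.2.1.of_le (m := minSmoothness ℝ 2) (by
      rw [minSmoothness_of_isRCLikeNormedField]; exact WithTop.coe_le_coe.2 (le_top : (2 : ℕ∞) ≤ ⊤))) le_rfl
  rw [ffBoundary_apply, ffBoundary_apply, h, map_zero, LinearMap.zero_apply]

theorem flatNorm_le_ffMass (T : FFCurrent d k) : flatNorm T ≤ ffMass T := by
  refine (iInf₂_le T 0).trans ((iInf_le _ ?_).trans ?_)
  · rw [ffBoundary, LinearMap.zero_comp, add_zero]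
  · rw [ffMass_zero, add_zero]

theorem extD_zero_apply (ω : TestForm d 0) (x : Euc d) (v : Fin 1 → Euc d) :
    (extD d 0 ω).1 x v = fderiv ℝ (testToLip d ω).1 x (v 0) := by
  change extDeriv ω.1 x v = _
  rw [extDeriv_apply ((ω.2.1.differentiable (by simp)) x)]
  have : (fun y => ω.1 y (Fin.removeNth 0 v)) = (testToLip d ω).1 :=
    funext fun y => (testToLip_apply ω y _).symm
  rw [Fin.sum_univ_one, this, Fin.val_zero, pow_zero, one_smul]

/-- This is the link between mass and the Kantorovich–Rubinstein norm: a current of dimension one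
tested on `dω` is controlled by the Lipschitz constant of `ω`. -/
theorem norm_extD_zero_le {ω : TestForm d 0} {K : ℝ≥0} (h : LipschitzWith K (testToLip d ω).1)
    (x : Euc d) : ‖(extD d 0 ω).1 x‖ ≤ K := by
  refine ContinuousAlternatingMap.opNorm_le_bound _ K.2 fun v => ?_
  rw [extD_zero_apply]
  rw [Fin.prod_univ_one]
  exact (ContinuousLinearMap.le_opNorm _ _).trans
    (mul_le_mul_of_nonneg_right (norm_fderiv_le_of_lipschitz ℝ h) (norm_nonneg _))

end ffMass

/-! ### Boundaries of flat chains belong to the Arens-Eells space -/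

section flatChains

variable {d k : ℕ}

/-- Multiplication of a test form by a smooth function. -/
def mulForm (χ : Euc d → ℝ) (hχ : ContDiff ℝ (⊤ : ℕ∞) χ) : TestForm d k →ₗ[ℝ] TestForm d k where
  toFun ω := ⟨fun x => χ x • ω.1 x, hχ.smul ω.2.1,
    ω.2.2.mono fun x hx h0 => hx (show χ x • ω.1 x = 0 by rw [h0, smul_zero])⟩
  map_add' ω η := by
    ext1
    funext x
    exact smul_add _ _ _
  map_smul' c ω := by
    ext1
    funext x
    exact smul_comm (χ x) c (ω.1 x)

theorem mulForm_apply (χ : Euc d → ℝ) (hχ : ContDiff ℝ (⊤ : ℕ∞) χ) (ω : TestForm d k) (x : Euc d) :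
    (mulForm χ hχ ω).1 x = χ x • ω.1 x := rfl

/-- Leibniz rule, with the second term arranged as the function times `dχ`: it is supported in a
fixed compact set and involves only the values of the function. -/
theorem extD_mulForm (χ : Euc d → ℝ) (hχ : ContDiff ℝ (⊤ : ℕ∞) χ) (hc : HasCompactSupport χ)
    (ω : TestForm d 0) :
    extD d 0 (mulForm χ hχ ω) = mulForm χ hχ (extD d 0 ω)
      + mulForm (testToLip d ω).1 (contDiff_testToLip ω) (extD d 0 (scalarForm χ hχ hc)) := by
  ext1
  funext x
  ext v
  have h1 : (testToLip d (mulForm χ hχ ω)).1 = fun y => χ y * (testToLip d ω).1 y := rfl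
  rw [extD_zero_apply, h1, fderiv_fun_mul ((hχ.differentiable (by simp)) x)
    (((contDiff_testToLip ω).differentiable (by simp)) x)]
  change _ = χ x * (extD d 0 ω).1 x v
    + (testToLip d ω).1 x * (extD d 0 (scalarForm χ hχ hc)).1 x v
  rw [extD_zero_apply, extD_zero_apply, testToLip_scalarForm]
  rfl

theorem exists_lt_toReal_ffMass (T : FFCurrent d k) {ε : ℝ} (hε : 0 < ε) :
    ∃ ω : TestForm d k, (∀ x, ‖ω.1 x‖ ≤ 1) ∧ (ffMass T).toReal - ε < T ω := by
  by_contra! h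
  have h0 := h 0 fun x => by simp
  rw [map_zero] at h0
  have h1 := ENNReal.toReal_le_of_le_ofReal h0 (ffMass_le h)
  linarith

/-- A current of finite mass is approximated in mass by its restrictions to large balls. -/
theorem exists_ffMass_sub_mulForm_le {T : FFCurrent d k} (hT : ffMass T ≠ ∞) {ε : ℝ} (hε : 0 < ε) :
    ∃ (χ : Euc d → ℝ) (hχ : ContDiff ℝ (⊤ : ℕ∞) χ), HasCompactSupport χ ∧ (∀ x, |χ x| ≤ 1) ∧
      ffMass (T - T.comp (mulForm χ hχ)) ≤ ENNReal.ofReal ε := by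
  obtain ⟨ω, hω, hTω⟩ := exists_lt_toReal_ffMass T hε
  obtain ⟨R, hR, hsub⟩ := ω.2.2.isCompact.isBounded.subset_closedBall_lt 0 0
  let φ : ContDiffBump (0 : Euc d) := ⟨R, R + 1, hR, lt_add_one R⟩
  refine ⟨φ, φ.contDiff, φ.hasCompactSupport, fun x => ?_, ffMass_le fun η hη => ?_⟩
  · rw [abs_of_nonneg φ.nonneg]; exact φ.le_one
  -- `ω` nearly attains the mass of `T`, and the tail `(1 - φ) η` vanishes on its support. Their sum
  -- is thus still admissible, so the tail can contribute at most `ε`.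
  have hpt : ∀ x, ‖(ω + (η - mulForm φ φ.contDiff η)).1 x‖ ≤ 1 := by
    intro x
    have e : (ω + (η - mulForm φ φ.contDiff η)).1 x = ω.1 x + (1 - φ x) • η.1 x := by
      have h := sub_smul 1 (φ x) (η.1 x)
      rw [one_smul] at h
      exact congrArg (ω.1 x + ·) h.symm
    rw [e]
    by_cases hx : x ∈ tsupport ω.1
    · rw [φ.one_of_mem_closedBall (hsub hx), sub_self, zero_smul, add_zero]
      exact hω x
    · rw [image_eq_zero_of_notMem_tsupport hx, zero_add, norm_smul,
        Real.norm_of_nonneg (sub_nonneg.2 φ.le_one)]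
      exact mul_le_one₀ (by linarith [φ.nonneg (x := x)]) (norm_nonneg _) (hη x)
  have h1 := (le_abs_self _).trans (abs_le_ffMass hT hpt)
  rw [map_add T ω, map_sub T η, mul_one] at h1
  change T η - T (mulForm φ φ.contDiff η) ≤ ε
  linarith

/-- One writes `N(dω) = (N - N⌞χ)(dω) + ∂N(χω) - N(ω dχ)` for a cutoff `χ`. The first term is small
by the choice of `χ`. The others see `ω` only on a compact set, where it is at most `K * δ` if it
vanishes on a finite `δ`-net; finiteness of both masses enters here. -/
theorem IsNormal.exists_bound {N : FFCurrent d 1} (hN : IsNormal N) {ε : ℝ} (hε : 0 < ε) :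
    ∃ F : Finset (Euc d), ∀ (ω : TestForm d 0) (K : ℝ≥0), LipschitzWith K (testToLip d ω).1 →
      (∀ x ∈ F, (testToLip d ω).1 x = 0) → |N (extD d 0 ω)| ≤ ε * K := by
  have hε2 : 0 < ε / 2 := half_pos hε
  obtain ⟨χ, hχ, hc, hχ1, hm⟩ := exists_ffMass_sub_mulForm_le hN.1.ne hε2
  obtain ⟨C, hC⟩ := (testToLip d (scalarForm χ hχ hc)).2
  set σ := scalarForm χ hχ hc with hσ
  -- `P` collects the coefficients of `K * δ` in the last two terms; `δ` is chosen below with `P +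
  -- 1` in the denominator since `P` may vanish.
  set P : ℝ := (ffMass (ffBoundary N)).toReal + (ffMass N).toReal * C with hP
  have hP0 : 0 ≤ P := by positivity
  set δ : ℝ := ε / 2 / (P + 1) with hδ
  have hδ0 : 0 < δ := by positivity
  have hPδ : P * δ ≤ ε / 2 := by
    rw [hδ, mul_div_assoc', div_le_iff₀ (by positivity)]
    nlinarith
  obtain ⟨t, -, ht, hcov⟩ := (hc.isCompact.union (extD d 0 σ).2.2.isCompact).finite_cover_balls hδ0
  refine ⟨ht.toFinset, fun ω K hω hω0 => ?_⟩
  have hsmall : ∀ x ∈ tsupport χ ∪ tsupport (extD d 0 σ).1, |(testToLip d ω).1 x| ≤ K * δ := by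
    intro x hx
    obtain ⟨y, hy, hxy⟩ := mem_iUnion₂.1 (hcov hx)
    have := hω.dist_le_mul x y
    rw [hω0 y (ht.mem_toFinset.2 hy), Real.dist_eq, sub_zero] at this
    exact this.trans (mul_le_mul_of_nonneg_left (Metric.mem_ball.1 hxy).le K.2)
  have hKδ : 0 ≤ K * δ := by positivity
  have h1 : |(N - N.comp (mulForm χ hχ)) (extD d 0 ω)| ≤ ε / 2 * K := by
    refine (abs_le_ffMass (hm.trans_lt ENNReal.ofReal_lt_top).ne (norm_extD_zero_le hω)).trans ?_
    exact mul_le_mul_of_nonneg_right (ENNReal.toReal_le_of_le_ofReal hε2.le hm) K.2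
  have h2 : |ffBoundary N (mulForm χ hχ ω)| ≤ (ffMass (ffBoundary N)).toReal * (K * δ) := by
    refine abs_le_ffMass hN.2.ne fun x => ?_
    rw [mulForm_apply, norm_smul, norm_testForm_zero]
    by_cases hx : x ∈ tsupport χ
    · exact (mul_le_of_le_one_left (abs_nonneg _) (hχ1 x)).trans (hsmall x (Or.inl hx))
    · rw [image_eq_zero_of_notMem_tsupport hx, norm_zero, zero_mul]
      exact hKδ
  have h3 : |N (mulForm (testToLip d ω).1 (contDiff_testToLip ω) (extD d 0 σ))|
      ≤ (ffMass N).toReal * (K * δ * C) := by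
    refine abs_le_ffMass hN.1.ne fun x => ?_
    rw [mulForm_apply, norm_smul]
    by_cases hx : x ∈ tsupport (extD d 0 σ).1
    · exact mul_le_mul (hsmall x (Or.inr hx)) (norm_extD_zero_le hC x) (norm_nonneg _) hKδ
    · rw [image_eq_zero_of_notMem_tsupport hx, norm_zero, mul_zero]
      exact mul_nonneg hKδ C.2
  have e : N (extD d 0 ω) = (N - N.comp (mulForm χ hχ)) (extD d 0 ω) + (ffBoundary N (mulForm χ hχ ω)
      - N (mulForm (testToLip d ω).1 (contDiff_testToLip ω) (extD d 0 σ))) := by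
    rw [ffBoundary_apply, extD_mulForm χ hχ hc ω, map_add N, LinearMap.sub_apply,
      LinearMap.comp_apply]
    ring
  rw [e]
  calc _ ≤ ε / 2 * K + ((ffMass (ffBoundary N)).toReal * (K * δ)
        + (ffMass N).toReal * (K * δ * C)) :=
        (abs_add_le _ _).trans (add_le_add h1 ((abs_sub _ _).trans (add_le_add h2 h3)))
    _ = ε / 2 * K + P * δ * K := by rw [hP]; ring
    _ ≤ ε / 2 * K + ε / 2 * K := by gcongr
    _ = ε * K := by ring

/-- Flat closeness means `T - N = R + ∂S` with `R` of small mass. The boundary annihilates `∂S`, so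
`∂T` differs from `∂N` by `∂R`, which is uniformly small on `K`-Lipschitz functions. -/
theorem IsFlatChain.exists_bound {T : FFCurrent d 1} (hT : IsFlatChain T) {ε : ℝ} (hε : 0 < ε) :
    ∃ F : Finset (Euc d), ∀ (ω : TestForm d 0) (K : ℝ≥0), LipschitzWith K (testToLip d ω).1 →
      (∀ x ∈ F, (testToLip d ω).1 x = 0) → |ffBoundary T ω| ≤ ε * K := by
  have hε2 : 0 < ε / 2 := half_pos hε
  obtain ⟨N, hN, hflat⟩ := hT.2 (ENNReal.ofReal (ε / 2)) (ENNReal.ofReal_pos.2 hε2)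
  obtain ⟨R, hflat⟩ := iInf_lt_iff.1 hflat
  obtain ⟨S, hflat⟩ := iInf_lt_iff.1 hflat
  obtain ⟨hRS, hflat⟩ := iInf_lt_iff.1 hflat
  have hR : ffMass R ≤ ENNReal.ofReal (ε / 2) := le_self_add.trans hflat.le
  obtain ⟨F, hF⟩ := hN.exists_bound hε2
  refine ⟨F, fun ω K hω hω0 => ?_⟩
  have e : ffBoundary T ω = R (extD d 0 ω) + N (extD d 0 ω) := by
    have h1 : T = R + ffBoundary S + N := by rw [hRS, sub_add_cancel]
    rw [h1, ffBoundary_add, ffBoundary_add, ffBoundary_ffBoundary, add_zero, LinearMap.add_apply,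
      ffBoundary_apply, ffBoundary_apply]
  have h1 : |R (extD d 0 ω)| ≤ ε / 2 * K := by
    refine (abs_le_ffMass (hR.trans_lt ENNReal.ofReal_lt_top).ne (norm_extD_zero_le hω)).trans ?_
    exact mul_le_mul_of_nonneg_right (ENNReal.toReal_le_of_le_ofReal hε2.le hR) K.2
  rw [e]
  calc _ ≤ ε / 2 * K + ε / 2 * K := (abs_add_le _ _).trans (add_le_add h1 (hF ω K hω hω0))
    _ = ε * K := by ring

theorem abs_ffBoundary_le {T : FFCurrent d 1} (hT : ffMass T ≠ ∞) (ω : TestForm d 0) (K : ℝ≥0)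
    (hω : LipschitzWith K (testToLip d ω).1) : |ffBoundary T ω| ≤ (ffMass T).toReal * K :=
  abs_le_ffMass hT (norm_extD_zero_le hω)

theorem IsFlatChain.exists_toDistribution_eq {T : FFCurrent d 1} (hT : IsFlatChain T) :
    ∃ u : AE (Euc d), toDistribution (toFunctional u) = ffBoundary T := by
  obtain ⟨u, hu⟩ := exists_toFunctional_eq (isLipDense_testToLip d) (ffBoundary T)
    (abs_ffBoundary_le hT.1.ne) fun ε hε => hT.exists_bound hε
  exact ⟨u, LinearMap.ext hu⟩

end flatChains

/-! ### Filling by polygonal flat chains -/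

section segments

variable {d : ℕ}

theorem continuous_segment_integrand (x y : Euc d) (ω : TestForm d 1) :
    Continuous fun t : ℝ => ω.1 (x + t • (y - x)) fun _ => y - x := by
  have h1 : Continuous ω.1 := ω.2.1.continuous
  have h2 : Continuous fun t : ℝ => ω.1 (x + t • (y - x)) := h1.comp (by fun_prop)
  exact (ContinuousAlternatingMap.apply ℝ (Euc d) ℝ (fun _ : Fin 1 => y - x)).continuous.comp h2

/-- The current of integration along the segment from `x` to `y`. -/
def segmentCurrent (x y : Euc d) : FFCurrent d 1 where
  toFun ω := ∫ t in (0 : ℝ)..1, ω.1 (x + t • (y - x)) fun _ => y - x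
  map_add' ω η := by
    rw [← intervalIntegral.integral_add
      ((continuous_segment_integrand x y ω).intervalIntegrable 0 1)
      ((continuous_segment_integrand x y η).intervalIntegrable 0 1)]
    rfl
  map_smul' c ω := by
    rw [RingHom.id_apply, smul_eq_mul, ← intervalIntegral.integral_const_mul]
    rfl

theorem ffMass_segmentCurrent_le (x y : Euc d) :
    ffMass (segmentCurrent x y) ≤ ENNReal.ofReal (dist x y) := by
  refine ffMass_le fun ω hω => (le_abs_self _).trans ?_
  have := intervalIntegral.norm_integral_le_of_norm_le_const (a := 0) (b := 1) (C := dist x y)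
    (f := fun t : ℝ => ω.1 (x + t • (y - x)) fun _ => y - x) fun t _ => by
      refine (ContinuousAlternatingMap.le_opNorm _ _).trans ?_
      rw [Fin.prod_univ_one, dist_comm, dist_eq_norm]
      exact mul_le_of_le_one_left (norm_nonneg _) (hω _)
  rwa [sub_zero, abs_one, mul_one] at this

theorem ffBoundary_segmentCurrent (x y : Euc d) :
    ffBoundary (segmentCurrent x y) = toDistribution (toFunctional (atomMolecule y x : AE (Euc d))) := by
  ext ω
  have hf := contDiff_testToLip ω
  set f := (testToLip d ω).1 with hfdef
  change ∫ t in (0 : ℝ)..1, (extD d 0 ω).1 (x + t • (y - x)) (fun _ => y - x) =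
    toFunctional (atomMolecule y x : AE (Euc d)) (testToLip d ω)
  rw [toFunctional_coe, moleculePairing_atomMolecule]
  have hderiv : ∀ t : ℝ, HasDerivAt (fun t : ℝ => f (x + t • (y - x)))
      ((extD d 0 ω).1 (x + t • (y - x)) (fun _ => y - x)) t := by
    intro t
    rw [extD_zero_apply]
    have h1 : HasDerivAt (fun t : ℝ => x + t • (y - x)) (y - x) t := by
      simpa using ((hasDerivAt_id t).smul_const (y - x)).const_add x
    exact ((hf.differentiable (by simp)) _).hasFDerivAt.comp_hasDerivAt t h1
  rw [intervalIntegral.integral_eq_sub_of_hasDerivAt (fun t _ => hderiv t)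
    ((continuous_segment_integrand x y (extD d 0 ω)).intervalIntegrable 0 1)]
  simp [hfdef]

theorem isNormal_segmentCurrent (x y : Euc d) : IsNormal (segmentCurrent x y) := by
  refine ⟨(ffMass_segmentCurrent_le x y).trans_lt ENNReal.ofReal_lt_top, ?_⟩
  -- The boundary is a difference of two point masses.
  refine (ffMass_le (C := 2) fun ω hω => ?_).trans_lt ENNReal.ofReal_lt_top
  rw [ffBoundary_segmentCurrent]
  change toFunctional (atomMolecule y x : AE (Euc d)) (testToLip d ω) ≤ 2
  rw [toFunctional_coe, moleculePairing_atomMolecule]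
  have hx := hω x
  have hy := hω y
  rw [norm_testForm_zero] at hx hy
  linarith [(abs_le.1 hx).1, (abs_le.1 hy).2]

/-- The functional `u` is the boundary of a normal current of mass at most `r`. -/
def HasNormalFilling (u : AE (Euc d)) (r : ℝ) : Prop :=
  0 ≤ r ∧ ∃ T : FFCurrent d 1, IsNormal T ∧ ffBoundary T = toDistribution (toFunctional u) ∧
    ffMass T ≤ ENNReal.ofReal r

theorem IsNormal.add {S T : FFCurrent d 1} (hS : IsNormal S) (hT : IsNormal T) :
    IsNormal (S + T) :=
  ⟨(ffMass_add_le S T).trans_lt (ENNReal.add_lt_top.2 ⟨hS.1, hT.1⟩), by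
    rw [ffBoundary_add]
    exact (ffMass_add_le (ffBoundary S) (ffBoundary T)).trans_lt
      (ENNReal.add_lt_top.2 ⟨hS.2, hT.2⟩)⟩

theorem IsNormal.smul (c : ℝ) {T : FFCurrent d 1} (hT : IsNormal T) : IsNormal (c • T) :=
  ⟨(ffMass_smul_le c T).trans_lt (ENNReal.mul_lt_top ENNReal.ofReal_lt_top hT.1), by
    rw [ffBoundary_smul]
    exact (ffMass_smul_le c (ffBoundary T)).trans_lt
      (ENNReal.mul_lt_top ENNReal.ofReal_lt_top hT.2)⟩

theorem IsNormal.zero : IsNormal (0 : FFCurrent d 1) := by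
  refine ⟨by rw [ffMass_zero]; exact ENNReal.zero_lt_top, ?_⟩
  rw [ffBoundary, LinearMap.zero_comp, ffMass_zero]
  exact ENNReal.zero_lt_top

theorem HasNormalFilling.zero : HasNormalFilling (0 : AE (Euc d)) 0 := by
  refine ⟨le_rfl, 0, IsNormal.zero, ?_, by rw [ffMass_zero]; exact zero_le⟩
  rw [← toFunctionalLM_apply, map_zero]
  rfl

theorem HasNormalFilling.add {u v : AE (Euc d)} {r s : ℝ} (hu : HasNormalFilling u r)
    (hv : HasNormalFilling v s) : HasNormalFilling (u + v) (r + s) := by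
  obtain ⟨hr, S, hS, hb, hm⟩ := hu
  obtain ⟨hs, T, hT, hb', hm'⟩ := hv
  refine ⟨add_nonneg hr hs, S + T, hS.add hT, ?_, ?_⟩
  · rw [ffBoundary_add, hb, hb', toFunctional_add]
    rfl
  · rw [ENNReal.ofReal_add hr hs]
    exact (ffMass_add_le S T).trans (add_le_add hm hm')

theorem HasNormalFilling.smul (c : ℝ) {u : AE (Euc d)} {r : ℝ} (hu : HasNormalFilling u r) :
    HasNormalFilling (c • u) (|c| * r) := by
  obtain ⟨hr, T, hT, hb, hm⟩ := hu
  refine ⟨mul_nonneg (abs_nonneg c) hr, c • T, hT.smul c, ?_, ?_⟩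
  · rw [ffBoundary_smul, hb, toFunctional_smul]
    rfl
  · rw [ENNReal.ofReal_mul (abs_nonneg c)]
    refine (ffMass_smul_le c T).trans ?_
    gcongr

theorem IsNormal.sum {T : ℕ → FFCurrent d 1} (h : ∀ k, IsNormal (T k)) (s : Finset ℕ) :
    IsNormal (∑ k ∈ s, T k) :=
  Finset.sum_induction T IsNormal (fun _ _ => IsNormal.add) IsNormal.zero fun k _ => h k

/-- The partial sums are normal and converge in mass, hence in the flat norm; the boundary masses
need not be summable, so the limit is only a flat chain. -/
theorem exists_isFlatChain_hasSum {T : ℕ → FFCurrent d 1} (hT : ∀ k, IsNormal (T k)) {r : ℕ → ℝ}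
    (hr0 : ∀ k, 0 ≤ r k) (hm : ∀ k, ffMass (T k) ≤ ENNReal.ofReal (r k)) (hr : Summable r) :
    ∃ T' : FFCurrent d 1, IsFlatChain T' ∧ (∀ ω, HasSum (fun k => T k ω) (T' ω)) ∧
      ffMass T' ≤ ENNReal.ofReal (∑' k, r k) := by
  have hb : ∀ (ω : TestForm d 1) (B : ℝ), 0 ≤ B → (∀ x, ‖ω.1 x‖ ≤ B) → ∀ k, ‖T k ω‖ ≤ r k * B :=
    fun ω B hB hω k => (abs_le_ffMass (hT k).1.ne hω).trans
      (mul_le_mul_of_nonneg_right (ENNReal.toReal_le_of_le_ofReal (hr0 k) (hm k)) hB)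
  have hs : ∀ ω : TestForm d 1, Summable fun k => T k ω := by
    intro ω
    obtain ⟨B, hB⟩ := ω.2.2.exists_bound_of_continuous ω.2.1.continuous
    exact Summable.of_norm_bounded (hr.mul_right B) (hb ω B ((norm_nonneg _).trans (hB 0)) hB)
  let T' : FFCurrent d 1 :=
    { toFun := fun ω => ∑' k, T k ω
      map_add' := fun ω η => by
        rw [← (hs ω).tsum_add (hs η)]
        exact tsum_congr fun k => map_add (T k) ω η
      map_smul' := fun c ω => by
        rw [RingHom.id_apply, smul_eq_mul, ← tsum_mul_left]
        exact tsum_congr fun k => (T k).map_smul c ω }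
  have hsum : ∀ ω, HasSum (fun k => T k ω) (T' ω) := fun ω => (hs ω).hasSum
  have htail : ∀ n, ffMass (T' - ∑ k ∈ Finset.range n, T k)
      ≤ ENNReal.ofReal (∑' k, r (k + n)) := by
    intro n
    refine ffMass_le fun ω hω => ?_
    have h1 : HasSum (fun k => T (k + n) ω) ((T' - ∑ k ∈ Finset.range n, T k) ω) := by
      rw [LinearMap.sub_apply, LinearMap.sum_apply]
      exact (hasSum_nat_add_iff' n).2 (hsum ω)
    refine hasSum_le (fun k => (le_abs_self _).trans ?_) h1
      ((summable_nat_add_iff n).2 hr).hasSum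
    simpa using hb ω 1 zero_le_one hω (k + n)
  have hmass : ffMass T' ≤ ENNReal.ofReal (∑' k, r k) := by
    simpa using htail 0
  refine ⟨T', ⟨hmass.trans_lt ENNReal.ofReal_lt_top, fun ε hε => ?_⟩, hsum, hmass⟩
  have hlim : Tendsto (fun n => ENNReal.ofReal (∑' k, r (k + n))) atTop (𝓝 0) := by
    simpa using ENNReal.tendsto_ofReal (tendsto_sum_nat_add r)
  obtain ⟨n, hn⟩ := (hlim.eventually_lt_const hε).exists
  exact ⟨∑ k ∈ Finset.range n, T k, IsNormal.sum hT _,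
    (flatNorm_le_ffMass _).trans_lt ((htail n).trans_lt hn)⟩

theorem exists_isFlatChain_ffBoundary_eq (u : AE (Euc d)) {ε : ℝ} (hε : 0 < ε) :
    ∃ T : FFCurrent d 1, IsFlatChain T ∧ ffBoundary T = toDistribution (toFunctional u) ∧
      ffMass T ≤ ENNReal.ofReal (‖u‖ + ε) := by
  -- A segment fills its atom exactly and at cost `dist x y`, so no approximation error occurs and
  -- `c = 1`.
  have hatom : ∀ (x y : Euc d) (ε : ℝ), 0 < ε → ∃ v, ‖(atomMolecule x y : AE (Euc d)) - v‖ < ε ∧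
      HasNormalFilling v (1 * dist x y) := fun x y ε hε =>
    ⟨_, by rwa [sub_self, norm_zero], by
      rw [one_mul, dist_comm]
      exact ⟨dist_nonneg, _, isNormal_segmentCurrent y x, ffBoundary_segmentCurrent y x,
        ffMass_segmentCurrent_le y x⟩⟩
  obtain ⟨v, r, hG, hsum, hr, hle⟩ := AE.exists_hasSum zero_le_one (G := HasNormalFilling)
    (fun _ _ h => h.1) HasNormalFilling.zero (fun _ _ _ _ => HasNormalFilling.add)
    (fun a _ _ => HasNormalFilling.smul a) hatom u hε
  choose hr0 T hT hb hm using hG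
  obtain ⟨T', hT', hTsum, hm'⟩ := exists_isFlatChain_hasSum hT hr0 hm hr
  refine ⟨T', hT', ?_, hm'.trans (ENNReal.ofReal_le_ofReal (by rwa [one_mul] at hle))⟩
  ext ω
  refine (hTsum (extD d 0 ω)).unique ?_
  have e : ∀ k, T k (extD d 0 ω) = toFunctional (v k) (testToLip d ω) := fun k =>
    LinearMap.congr_fun (hb k) ω
  simp only [e]
  exact hsum (testToLip d ω)

theorem image_toDistribution_eq (d : ℕ) :
    toDistribution '' M01 d = {D | ∃ T : FFCurrent d 1, IsFlatChain T ∧ ffBoundary T = D} := by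
  rw [← range_toFunctional_eq_M01]
  refine Subset.antisymm ?_ ?_
  · rintro _ ⟨_, ⟨u, rfl⟩, rfl⟩
    obtain ⟨T, hT, hb, -⟩ := exists_isFlatChain_ffBoundary_eq u one_pos
    exact ⟨T, hT, hb⟩
  · rintro _ ⟨T, hT, rfl⟩
    obtain ⟨u, hu⟩ := hT.exists_toDistribution_eq
    exact ⟨_, mem_range_self u, hu⟩

/-- A filling is known only through its action on test forms, so the lower bound uses that compactly
supported smooth 1-Lipschitz functions already determine the norm. The upper bound comes from the
series of segments. -/
theorem krNorm_eq_iInf_ffMass (u : AE (Euc d)) :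
    krNorm (toFunctional u)
      = ⨅ (T : FFCurrent d 1)
          (_ : IsFlatChain T ∧ ffBoundary T = toDistribution (toFunctional u)), ffMass T := by
  rw [krNorm_toFunctional]
  refine le_antisymm (le_iInf₂ fun T hT => ?_) ?_
  · rw [ENNReal.ofReal_le_iff_le_toReal hT.1.1.ne]
    refine norm_le_of_isLipDense (isLipDense_testToLip d) u fun ω hω => ?_
    have h1 := (le_abs_self _).trans (abs_ffBoundary_le hT.1.1.ne ω 1 hω)
    rw [hT.2, NNReal.coe_one, mul_one] at h1
    exact h1
  · refine ENNReal.le_of_forall_pos_le_add fun ε hε _ => ?_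
    obtain ⟨T, hT, hb, hm⟩ := exists_isFlatChain_ffBoundary_eq u (NNReal.coe_pos.2 hε)
    refine (iInf₂_le T ⟨hT, hb⟩).trans (hm.trans ?_)
    rw [ENNReal.ofReal_add (norm_nonneg u) (NNReal.coe_nonneg ε), ENNReal.ofReal_coe_nnreal]

end segments

end MetricBoundary

end

open MetricBoundary in
theorem mainTheorem9 :
    -- piecewise quasiconvex spaces
    (∀ (X : Type*) [MetricSpace X] [TopologicalSpace.SeparableSpace X] [MeasurableSpace X]
        [BorelSpace X], PiecewiseQuasiconvex X →
      (∀ u : AE X, krNorm (toFunctional u) = ENNReal.ofReal ‖u‖) ∧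
      range (toFunctional : AE X → LipFun X →ₗ[ℝ] ℝ)
        = {φ | ∃ T, IsMetricCurrent T ∧ boundary T = φ} ∧
      range (toFunctional : AE X → LipFun X →ₗ[ℝ] ℝ)
        = {φ | ∃ T, IsMetricCurrent T ∧ IsRectifiable T ∧ boundary T = φ}) ∧
    -- geodesic spaces
    (∀ (X : Type*) [MetricSpace X] [TopologicalSpace.SeparableSpace X] [MeasurableSpace X]
        [BorelSpace X], Geodesic X → ∀ u : AE X,
      krNorm (toFunctional u)
        = ⨅ (T) (_ : IsMetricCurrent T ∧ boundary T = toFunctional u), mass T) ∧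
    -- Euclidean spaces
    (∀ d : ℕ,
      range (toFunctional : AE (Euc d) → LipFun (Euc d) →ₗ[ℝ] ℝ) = M01 d ∧
      InjOn toDistribution (M01 d) ∧
      toDistribution '' M01 d = {D | ∃ T : FFCurrent d 1, IsFlatChain T ∧ ffBoundary T = D} ∧
      ∀ u : AE (Euc d), krNorm (toFunctional u)
        = ⨅ (T : FFCurrent d 1)
            (_ : IsFlatChain T ∧ ffBoundary T = toDistribution (toFunctional u)), ffMass T) := by
  refine ⟨fun X _ _ _ _ h => ⟨krNorm_toFunctional, range_toFunctional_eq_boundaries h⟩,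
    fun X _ _ _ _ h u => krNorm_eq_iInf_mass h u, fun d => ⟨range_toFunctional_eq_M01 d,
      injOn_toDistribution d, image_toDistribution_eq d, krNorm_eq_iInf_ffMass⟩⟩
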